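/- Let $\mathcal K$ be a locally small, locally finitely presentable additive category. Call a morphism $h:K\to L$ of $\mathcal K$ \emph{pure} if for every commutative square $hu=vf$ with $f:M\to N$ a morphism between finitely presentable objects, $u:M\to K$ and $v:N\to L$, there is $g:N\to K$ with $gf=u$. An object $Q$ is \emph{injective} with respect to a morphism $f:A\to B$ if every $a:A\to Q$ is of the form $a=bf$ for some $b:B\to Q$; it is \emph{pure injective} if it is injective with respect to every pure monomorphism. A set $\mathcal X$ of morphisms \emph{cofibrantly generates} a class $\mathcal M$ of morphisms if $\mathcal M$ is the closure of $\mathcal X$ under transfinite compositions, pushouts, and retracts in the category of morphisms, that is, the smallest class which contains $\mathcal X$ and is closed under these three operations. Then: \begin{enumerate} \item there is a (small) set $\mathcal X$ of pure monomorphisms which cofibrantly generates the class of all pure monomorphisms of $\mathcal K$; \item for every such set $\mathcal X$, an object of $\mathcal K$ is pure injective if and only if it is injective with respect to each morphism in $\mathcal X$; \item hence the pure injectives of $\mathcal K$ form a small-injectivity class, i.e. the class of all objects injective with respect to some set of morphisms; \item the full subcategory of $\mathcal K$ on the pure injectives is an accessible category. \end{enumerate} -/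

import Mathlib

universe v u

open CategoryTheory Limits

namespace PurityInCategories

variable {C : Type u} [Category.{v} C]

/-- A morphism `h : K ⟶ L` is pure if for every commutative square `u ≫ h = f ≫ v`
with `f : M ⟶ N` a morphism between finitely presentable objects, `u` factors through `f`. -/
def IsPure {K L : C} (h : K ⟶ L) : Prop :=
  ∀ ⦃M N : C⦄, IsFinitelyPresentable.{v} M → IsFinitelyPresentable.{v} N →
    ∀ (u : M ⟶ K) (f : M ⟶ N) (v : N ⟶ L), u ≫ h = f ≫ v → ∃ g : N ⟶ K, f ≫ g = u

variable (C) in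
/-- The class of pure monomorphisms. -/
def pureMonos : MorphismProperty C :=
  fun _ _ h => IsPure h ∧ Mono h

/-- The class of objects injective with respect to every morphism of the class `W`. -/
def injectives (W : MorphismProperty C) : ObjectProperty C :=
  fun X => ∀ ⦃A B : C⦄ (f : A ⟶ B), W f → ∀ a : A ⟶ X, ∃ b : B ⟶ X, f ≫ b = a

variable (C) in
/-- The class of pure injective objects. -/
def pureInjectives : ObjectProperty C :=
  injectives (pureMonos C)

/-- A class of objects is a small-injectivity class if it consists of the objects injective
with respect to all members of some (small) set of morphisms. -/
def IsSmallInjectivityClass (P : ObjectProperty C) : Prop :=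
  ∃ X : MorphismProperty C, MorphismProperty.IsSmall.{v} X ∧ P = injectives X

/-- A class of morphisms is cofibrantly closed if it is closed under transfinite compositions,
pushouts, and retracts in the category of morphisms. -/
structure IsCofibrantlyClosed (W : MorphismProperty C) : Prop where
  transfinite : MorphismProperty.IsStableUnderTransfiniteComposition.{v} W
  pushout : W.IsStableUnderCobaseChange
  retract : W.IsStableUnderRetracts

/-- The closure of a class of morphisms under transfinite compositions, pushouts and retracts,
that is, the smallest cofibrantly closed class containing it. -/
def cofibrantClosure (X : MorphismProperty C) : MorphismProperty C :=
  sInf {W : MorphismProperty C | IsCofibrantlyClosed W ∧ X ≤ W}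

/-- `X` is a (small) set of morphisms which cofibrantly generates the class `W`. -/
structure IsCofibrantlyGeneratingSet (X W : MorphismProperty C) : Prop where
  small : MorphismProperty.IsSmall.{v} X
  closure_eq : cofibrantClosure X = W

end PurityInCategories

namespace PurityInCategories

open Opposite Cardinal

/-! The category `C` need not be abelian, but an object is determined by the morphisms to it from
finitely presentable objects, and these groups of morphisms can be handled as in module theory. A
presheaf on the finitely presentable objects comes from an object as soon as its category of
elements is filtered; for a subquotient of a representable presheaf this is a left exactness
condition (`exists_subquotient`). Purity of `A ⟶ B` gives exactly this condition for the quotient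
`Hom(-, B)/Hom(-, A)`. So every pure monomorphism has a cokernel `Q` for which `Hom(N, -)` gives
short exact sequences, `N` finitely presentable (`IsPureExact`).

The generating set consists of the kernels of the canonical maps onto `R` from coproducts of
finitely presentable objects, with `R` running over representatives of the `κ`-presentable objects.
Given a pure `P ⟶ B` with quotient `Q` and an element of `B` outside `P`, a Löwenheim-Skolem
argument finds a small pure subobject `R` of `Q` containing its image. The preimage `P₁` of `R` is
pure in `B`, and `P ⟶ P₁` is a pushout of the generator of `R`, since the canonical map lifts to
`P₁` and a morphism of pure exact sequences with equal cokernels is a pushout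
(`exists_generating_pureMonos`). Iterating transfinitely exhausts `B`
(`pureMonos_le_of_isCofibrantlyClosed`); conversely pure monomorphisms are cofibrantly closed.

Injectivity of `Q` with respect to `f` is the left lifting property of `f` against `Q ⟶ 0`, so
passing to the cofibrant closure does not change the injectives. Finally, for a set of morphisms, an
injective object is a highly filtered union of small pure subobjects closed under chosen extensions,
which are again injective; this gives accessibility (`isAccessibleCategory_injectives`). -/

lemma coconeAt_ι_app {C : Type u} [Category.{v} C] {D : Type*} [Category* D] (F : D ⥤ C)
    (Q : C) (g : CostructuredArrow F Q) :
    ((Functor.LeftExtension.mk (𝟭 C) F.rightUnitor.inv).coconeAt Q).ι.app g = g.hom :=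
  Category.id_comp _

/-! ### Density of the finitely presentable objects. -/

section FinitelyPresentable

variable {C : Type u} [Category.{v} C] [IsLocallyFinitelyPresentable.{v} C]

/-- A morphism out of `Q` can be defined on a family of morphisms to `Q` through which all
morphisms from finitely presentable objects factor. -/
lemma exists_desc {I : Type*} {Q T : C} (Z : I → C) (m : ∀ i, Z i ⟶ Q)
    (hm : ∀ (N : C) [IsFinitelyPresentable.{v} N] (x : N ⟶ Q), ∃ i, ∃ y : N ⟶ Z i, y ≫ m i = x)
    (t : ∀ i, Z i ⟶ T)
    (ht : ∀ (N : C) [IsFinitelyPresentable.{v} N] (i j : I) (y : N ⟶ Z i) (y' : N ⟶ Z j),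
      y ≫ m i = y' ≫ m j → y ≫ t i = y' ≫ t j) :
    ∃ φ : Q ⟶ T, ∀ i, m i ≫ φ = t i := by
  let P := ObjectProperty.isFinitelyPresentable.{v} C
  have (N : P.FullSubcategory) : IsFinitelyPresentable.{v} N.obj := N.property
  -- `Q` is the colimit of the finitely presentable objects over it; `ht` makes the values on them
  -- independent of the chosen factorizations.
  choose i y hy using fun (g : CostructuredArrow P.ι Q) ↦ hm g.left.obj g.hom
  let c : Cocone (CostructuredArrow.proj P.ι Q ⋙ P.ι) :=
    { pt := T
      ι :=
        { app g := y g ≫ t (i g)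
          naturality g g' f := by
            have := ht _ (i g') (i g) (f.left.hom ≫ y g') (y g) (by
              rw [Category.assoc, hy, hy]
              exact CostructuredArrow.w f)
            simpa only [Category.assoc, Functor.const_obj_map, Category.comp_id, Functor.const_obj_obj] using! this } }
  refine ⟨(P.ι.denseAt Q).desc c, fun k ↦ (P.ι.denseAt (Z k)).hom_ext fun g ↦ ?_⟩
  let g' : CostructuredArrow P.ι Q := CostructuredArrow.mk (Y := g.left) (g.hom ≫ m k)
  have h1 := (P.ι.denseAt Q).fac c g'
  have h2 : y g' ≫ t (i g') = g.hom ≫ t k := ht _ (i g') k (y g') g.hom (hy g')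
  have h3 : g'.hom ≫ (P.ι.denseAt Q).desc c = y g' ≫ t (i g') := by rwa [coconeAt_ι_app] at h1
  have h4 : g.hom ≫ m k ≫ (P.ι.denseAt Q).desc c = g.hom ≫ t k := by
    rw [← h2, ← h3]
    exact (Category.assoc _ _ _).symm
  rw [coconeAt_ι_app]
  exact h4

lemma hom_ext_of_isFinitelyPresentable {Q T : C} {f g : Q ⟶ T}
    (h : ∀ (N : C) [IsFinitelyPresentable.{v} N] (x : N ⟶ Q), x ≫ f = x ≫ g) : f = g := by
  let P := ObjectProperty.isFinitelyPresentable.{v} C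
  have (N : P.FullSubcategory) : IsFinitelyPresentable.{v} N.obj := N.property
  refine (P.ι.denseAt Q).hom_ext fun x ↦ ?_
  have := h x.left.obj x.hom
  rwa [coconeAt_ι_app]

lemma mono_of_isFinitelyPresentable {Q T : C} (f : Q ⟶ T)
    (h : ∀ (N : C) [IsFinitelyPresentable.{v} N] (x y : N ⟶ Q), x ≫ f = y ≫ f → x = y) :
    Mono f :=
  ⟨fun a b hab ↦ hom_ext_of_isFinitelyPresentable fun N _ x ↦
    h N _ _ (by rw [Category.assoc, hab, Category.assoc])⟩

/-- As `m` is mono, lifts on finitely presentable objects are unique, hence compatible, and glue by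
density. -/
lemma exists_lift_of_mono {Z Q T : C} (m : Z ⟶ Q) [Mono m] (t : T ⟶ Q)
    (h : ∀ (N : C) [IsFinitelyPresentable.{v} N] (x : N ⟶ T), ∃ y : N ⟶ Z, y ≫ m = x ≫ t) :
    ∃ l : T ⟶ Z, l ≫ m = t := by
  let P := ObjectProperty.isFinitelyPresentable.{v} C
  have (N : P.FullSubcategory) : IsFinitelyPresentable.{v} N.obj := N.property
  choose l hl using fun (i : Σ N : P.FullSubcategory, (N.obj ⟶ T)) ↦ h i.1.obj i.2
  obtain ⟨φ, hφ⟩ := exists_desc _ (fun i : Σ N : P.FullSubcategory, (N.obj ⟶ T) ↦ i.2)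
    (fun N hN x ↦ ⟨⟨⟨N, hN⟩, x⟩, 𝟙 _, Category.id_comp _⟩) l
    (fun N _ i j y y' hy ↦ by
      rw [← cancel_mono m, Category.assoc, Category.assoc, hl, hl, reassoc_of% hy])
  refine ⟨φ, hom_ext_of_isFinitelyPresentable fun N hN x ↦ ?_⟩
  rw [← hl ⟨⟨N, hN⟩, x⟩, ← hφ, Category.assoc]

variable (C) in
/-- A small model of the category of finitely presentable objects. -/
abbrev FpModel : Type v := SmallModel.{v} (ObjectProperty.isFinitelyPresentable.{v} C).FullSubcategory

variable (C) in
/-- The inclusion of the finitely presentable objects. -/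
noncomputable def fpι : FpModel C ⥤ C :=
  (equivSmallModel _).inverse ⋙ (ObjectProperty.isFinitelyPresentable.{v} C).ι

instance : (fpι C).Full := by dsimp [fpι]; infer_instance
instance : (fpι C).Faithful := by dsimp [fpι]; infer_instance
instance : (fpι C).IsDense := by dsimp [fpι]; infer_instance
instance (X : FpModel C) : IsFinitelyPresentable.{v} ((fpι C).obj X) :=
  ((equivSmallModel _).inverse.obj X).property

lemma exists_fpι_iso (N : C) [hN : IsFinitelyPresentable.{v} N] :
    ∃ X : FpModel C, Nonempty ((fpι C).obj X ≅ N) :=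
  ⟨(equivSmallModel _).functor.obj ⟨N, hN⟩,
    ⟨(ObjectProperty.isFinitelyPresentable.{v} C).ι.mapIso ((equivSmallModel _).unitIso.symm.app _)⟩⟩

/-- The functor sending an object to the presheaf of morphisms from finitely presentable
objects. -/
noncomputable def fpYoneda : C ⥤ (FpModel C)ᵒᵖ ⥤ Type v :=
  yoneda ⋙ (Functor.whiskeringLeft _ _ _).obj (fpι C).op

end FinitelyPresentable

/-! ### Presheaves with filtered category of elements come from objects. -/

section Representability

variable {C : Type u} [Category.{v} C] [IsLocallyFinitelyPresentable.{v} C]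

variable (C) in
/-- The presheaf `fpYoneda` of a finitely presentable object is representable. -/
noncomputable def fpιCompFpYoneda : fpι C ⋙ fpYoneda ≅ yoneda :=
  (NatIso.ofComponents (fun X ↦ NatIso.ofComponents
    (fun _ ↦ ((Functor.FullyFaithful.ofFullyFaithful (fpι C)).homEquiv).toIso)
    (fun f ↦ by
      ext x
      exact (fpι C).map_comp f.unop x))
    (fun f ↦ by
      ext Y x
      exact (fpι C).map_comp x f) : yoneda ≅ fpι C ⋙ fpYoneda).symm

instance (J : Type v) [SmallCategory J] [IsFiltered J] :
    PreservesColimitsOfShape J (fpYoneda (C := C)) where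
  preservesColimit := ⟨fun hc ↦ ⟨evaluationJointlyReflectsColimits _ fun X ↦
    isColimitOfPreserves (coyoneda.obj (op ((fpι C).obj X.unop))) hc⟩⟩

/-- A filtered colimit of representable presheaves on finitely presentable objects
comes from an object. -/
lemma exists_fpYoneda_iso (D : (FpModel C)ᵒᵖ ⥤ Type v) [IsFiltered (CostructuredArrow yoneda D)] :
    ∃ Z : C, Nonempty (fpYoneda.obj Z ≅ D) := by
  let K := CostructuredArrow.proj yoneda D
  exact ⟨colimit (K ⋙ fpι C), ⟨IsColimit.coconePointsIsoOfNatIso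
    (isColimitOfPreserves fpYoneda (colimit.isColimit (K ⋙ fpι C)))
    (Presheaf.isColimitTautologicalCocone D)
    (Functor.isoWhiskerLeft K (fpιCompFpYoneda C))⟩⟩

end Representability

/-- By Yoneda, objects over `D` are elements of `D`, and the hypotheses are the axioms of
filteredness for them. -/
lemma isFiltered_costructuredArrow_yoneda {F : Type v} [SmallCategory F] (D : Fᵒᵖ ⥤ Type v)
    (h₁ : ∃ X, Nonempty (D.obj (op X)))
    (h₂ : ∀ (X Y : F) (x : D.obj (op X)) (y : D.obj (op Y)),
      ∃ (Z : F) (f : X ⟶ Z) (g : Y ⟶ Z) (z : D.obj (op Z)), D.map f.op z = x ∧ D.map g.op z = y)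
    (h₃ : ∀ (X Y : F) (f g : X ⟶ Y) (y : D.obj (op Y)), D.map f.op y = D.map g.op y →
      ∃ (Z : F) (h : Y ⟶ Z) (z : D.obj (op Z)), f ≫ h = g ≫ h ∧ D.map h.op z = y) :
    IsFiltered (CostructuredArrow yoneda D) where
  nonempty := by
    obtain ⟨X, ⟨x⟩⟩ := h₁
    exact ⟨CostructuredArrow.mk (yonedaEquiv.symm x)⟩
  cocone_objs a b := by
    obtain ⟨Z, f, g, z, hf, hg⟩ := h₂ _ _ (yonedaEquiv a.hom) (yonedaEquiv b.hom)
    refine ⟨CostructuredArrow.mk (yonedaEquiv.symm z), CostructuredArrow.homMk f ?_,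
      CostructuredArrow.homMk g ?_, trivial⟩
    · apply yonedaEquiv.injective
      dsimp
      rw [← yonedaEquiv_naturality, Equiv.apply_symm_apply]
      exact hf
    · apply yonedaEquiv.injective
      dsimp
      rw [← yonedaEquiv_naturality, Equiv.apply_symm_apply]
      exact hg
  cocone_maps a b f g := by
    have e (h : a ⟶ b) : D.map h.left.op (yonedaEquiv b.hom) = yonedaEquiv a.hom := by
      rw [yonedaEquiv_naturality, CostructuredArrow.w h]
    obtain ⟨Z, h, z, hfg, hz⟩ := h₃ _ _ f.left g.left (yonedaEquiv b.hom) ((e f).trans (e g).symm)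
    refine ⟨CostructuredArrow.mk (yonedaEquiv.symm z), CostructuredArrow.homMk h ?_, ?_⟩
    · apply yonedaEquiv.injective
      dsimp
      rw [← yonedaEquiv_naturality, Equiv.apply_symm_apply]
      exact hz
    · ext
      exact hfg

/-! ### Additive sieves and their subquotients. -/

section

variable {C : Type u} [Category.{v} C] [Preadditive C]

/-- A sieve on `B` is additive if its members with finitely presentable domain form
subgroups. -/
structure IsAdditiveSieve {B : C} (S : Sieve B) : Prop where
  zero (N : C) [IsFinitelyPresentable.{v} N] : S (0 : N ⟶ B)
  add {N : C} [IsFinitelyPresentable.{v} N] {x y : N ⟶ B} (hx : S x) (hy : S y) : S (x + y)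

lemma IsAdditiveSieve.neg {B : C} {S : Sieve B} {N : C} {x : N ⟶ B} (hx : S x) : S (-x) := by
  simpa using S.downward_closed hx (-𝟙 _)

/-- The setoid on a sieve `S` given by an additive sieve `R`. -/
def subquotientSetoid {B : C} (S : Sieve B) {R : Sieve B} (hR : IsAdditiveSieve R) (N : C)
    [IsFinitelyPresentable.{v} N] : Setoid {x : N ⟶ B // S x} where
  r x y := R (x.1 - y.1)
  iseqv :=
    { refl x := by simpa using hR.zero N
      symm h := by simpa using IsAdditiveSieve.neg h
      trans h h' := by simpa using hR.add h h' }

end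

section

variable {C : Type u} [Category.{v} C] [IsLocallyFinitelyPresentable.{v} C]

lemma isFinitelyPresentable_of_isColimit {J : Type} [SmallCategory J] [FinCategory J]
    {F : J ⥤ C} (c : Cocone F) (hc : IsColimit c) (hF : ∀ j, IsFinitelyPresentable.{v} (F.obj j)) :
    IsFinitelyPresentable.{v} c.pt := by
  have := Cardinal.fact_isRegular_aleph0.{v}
  exact isCardinalPresentable_of_isColimit c hc _
    (by rw [hasCardinalLT_aleph0_iff]; infer_instance)

lemma isFinitelyPresentable_biprod [Preadditive C] [HasBinaryBiproducts C] (M N : C) [IsFinitelyPresentable.{v} M]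
    [IsFinitelyPresentable.{v} N] : IsFinitelyPresentable.{v} (M ⊞ N) :=
  isFinitelyPresentable_of_isColimit _ (BinaryBiproduct.isColimit M N) (by
    rintro (_ | _) <;> dsimp <;> infer_instance)

lemma isFinitelyPresentable_cokernel [Preadditive C] {M N : C} (f : M ⟶ N) [IsFinitelyPresentable.{v} M]
    [IsFinitelyPresentable.{v} N] : IsFinitelyPresentable.{v} (cokernel f) :=
  isFinitelyPresentable_of_isColimit _ (colimit.isColimit (parallelPair f 0)) (by
    rintro (_ | _) <;> dsimp <;> infer_instance)

open ZeroObject in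
lemma isFinitelyPresentable_zero [HasZeroObject C] : IsFinitelyPresentable.{v} (0 : C) := by
  have h := isFinitelyPresentable_of_isColimit (C := C) (asEmptyCocone 0)
    (isZero_zero C).isInitial (by rintro ⟨⟨⟩⟩)
  exact h

variable [Preadditive C]

/-- The presheaf on finitely presentable objects given by the quotients of the members of `S`
by those of `R`. -/
noncomputable def subquotientPresheaf {B : C} (S : Sieve B) {R : Sieve B} (hR : IsAdditiveSieve R) :
    (FpModel C)ᵒᵖ ⥤ Type v where
  obj X := Quotient (subquotientSetoid S hR ((fpι C).obj X.unop))
  map f := ↾(Quotient.map (fun x ↦ ⟨(fpι C).map f.unop ≫ x.1, S.downward_closed x.2 _⟩)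
    (fun x y h ↦ by
      change R _
      rw [← Preadditive.comp_sub]
      exact R.downward_closed h _))
  map_id X := by
    ext x
    induction x using Quotient.inductionOn with | h x
    simp [Quotient.map_mk]
  map_comp f g := by
    ext x
    induction x using Quotient.inductionOn with | h x
    simp [Quotient.map_mk]

variable [HasBinaryBiproducts C] [HasZeroObject C]

open ZeroObject in
/-- Subquotients of representable functors satisfying a left exactness condition come from
an object. -/
lemma exists_subquotient {B : C} (S R : Sieve B) (hS : IsAdditiveSieve S) (hR : IsAdditiveSieve R)
    (h : ∀ ⦃G H : C⦄ [IsFinitelyPresentable.{v} G] [IsFinitelyPresentable.{v} H]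
      (f : G ⟶ H) (y : H ⟶ B), S y → R (f ≫ y) → ∃ (z : cokernel f ⟶ B),
        S z ∧ R (cokernel.π f ≫ z - y)) :
    ∃ (Z : C) (q : ∀ X : FpModel C, {x : (fpι C).obj X ⟶ B // S x} → ((fpι C).obj X ⟶ Z)),
      (∀ X, Function.Surjective (q X)) ∧ (∀ X x y, q X x = q X y ↔ R (x.1 - y.1)) ∧
      (∀ (X Y : FpModel C) (f : (fpι C).obj X ⟶ (fpι C).obj Y) y,
        f ≫ q Y y = q X ⟨f ≫ y.1, S.downward_closed y.2 f⟩) := by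
  let D := subquotientPresheaf S hR
  let mk (X : FpModel C) (x : (fpι C).obj X ⟶ B) (hx : S x) : D.obj (op X) :=
    Quotient.mk _ ⟨x, hx⟩
  have hmk {X Y : FpModel C} (f : X ⟶ Y) (y : (fpι C).obj Y ⟶ B) (hy : S y)
    (x : (fpι C).obj X ⟶ B) (hx : S x) : D.map f.op (mk Y y hy) = mk X x hx ↔
      R ((fpι C).map f ≫ y - x) := Quotient.eq (r := subquotientSetoid S hR ((fpι C).obj X))
  have : IsFiltered (CostructuredArrow yoneda D) := by
    refine isFiltered_costructuredArrow_yoneda D ?_ ?_ ?_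
    · have := isFinitelyPresentable_zero (C := C)
      obtain ⟨X, -⟩ := exists_fpι_iso (C := C) 0
      exact ⟨X, ⟨mk X 0 (hS.zero _)⟩⟩
    · intro X Y x y
      induction x using Quotient.inductionOn with | h x
      induction y using Quotient.inductionOn with | h y
      have := isFinitelyPresentable_biprod ((fpι C).obj X) ((fpι C).obj Y)
      obtain ⟨Z, ⟨e⟩⟩ := exists_fpι_iso ((fpι C).obj X ⊞ (fpι C).obj Y)
      refine ⟨Z, (fpι C).preimage (biprod.inl ≫ e.inv), (fpι C).preimage (biprod.inr ≫ e.inv),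
        mk Z (e.hom ≫ (biprod.fst ≫ x.1 + biprod.snd ≫ y.1))
          (S.downward_closed (hS.add (S.downward_closed x.2 _) (S.downward_closed y.2 _)) _),
          (hmk _ _ _ _ _).2 ?_, (hmk _ _ _ _ _).2 ?_⟩
      · simpa using hR.zero _
      · simpa using hR.zero _
    · intro X Y f g y hfg
      induction y using Quotient.inductionOn with | h y
      -- `f` and `g` agree on the class of `y` when `f - g` kills it, so the cokernel of `f - g`
      -- serves as the coequalizer.
      have hfg' : R ((fpι C).map f ≫ y.1 - (fpι C).map g ≫ y.1) :=
        (hmk f y.1 y.2 _ (S.downward_closed y.2 _)).1 hfg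
      rw [← Preadditive.sub_comp] at hfg'
      obtain ⟨z, hz, hR'⟩ := h _ _ y.2 hfg'
      have := isFinitelyPresentable_cokernel ((fpι C).map f - (fpι C).map g)
      obtain ⟨Z, ⟨e⟩⟩ := exists_fpι_iso (cokernel ((fpι C).map f - (fpι C).map g))
      refine ⟨Z, (fpι C).preimage (cokernel.π _ ≫ e.inv), mk Z (e.hom ≫ z) (S.downward_closed hz _),
        (fpι C).map_injective ?_, (hmk _ _ _ _ _).2 ?_⟩
      · rw [← sub_eq_zero]
        simp only [Functor.map_comp, Functor.map_preimage, ← Preadditive.sub_comp]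
        rw [cokernel.condition_assoc, zero_comp]
      · simpa using hR'
  obtain ⟨Z, ⟨e⟩⟩ := exists_fpYoneda_iso D
  refine ⟨Z, fun X x ↦ e.inv.app (op X) (mk X x.1 x.2), fun X x ↦ ?_, fun X x y ↦ ?_,
    fun X Y f y ↦ ?_⟩
  · obtain ⟨a, ha⟩ := Quotient.mk_surjective (e.hom.app (op X) x)
    refine ⟨a, ?_⟩
    change e.inv.app (op X) (Quotient.mk _ a) = _
    rw [ha]
    exact (e.app (op X)).toEquiv.symm_apply_apply x
  · exact (e.app (op X)).toEquiv.symm.injective.eq_iff.trans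
      (Quotient.eq (r := subquotientSetoid S hR ((fpι C).obj X)))
  · obtain ⟨f, rfl⟩ := (fpι C).map_surjective f
    exact (e.inv.naturality_apply f.op (mk Y y.1 y.2)).symm

end

/-! ### Pure exact sequences. -/

section

variable {C : Type u} [Category.{v} C]

/-- The sieve of morphisms which factor through a given morphism. -/
def factorSieve {A B : C} (h : A ⟶ B) : Sieve B where
  arrows _ x := ∃ y, y ≫ h = x
  downward_closed := by
    rintro _ _ _ ⟨y, rfl⟩ f
    exact ⟨f ≫ y, Category.assoc _ _ _⟩

lemma factorSieve_apply {A B : C} (h : A ⟶ B) {N : C} (x : N ⟶ B) :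
    factorSieve h x ↔ ∃ y, y ≫ h = x := Iff.rfl

variable [Preadditive C]

/-- The sieve of morphisms which become zero after composition with a given morphism. -/
def kernelSieve {B Q : C} (q : B ⟶ Q) : Sieve B where
  arrows _ x := x ≫ q = 0
  downward_closed h f := by rw [Category.assoc, h, comp_zero]

lemma kernelSieve_apply {B Q : C} (q : B ⟶ Q) {N : C} (x : N ⟶ B) :
    kernelSieve q x ↔ x ≫ q = 0 := Iff.rfl

lemma isAdditiveSieve_kernelSieve {B Q : C} (q : B ⟶ Q) : IsAdditiveSieve (kernelSieve q) where
  zero _ _ := by simp [kernelSieve_apply]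
  add hx hy := by
    rw [kernelSieve_apply] at hx hy ⊢
    rw [Preadditive.add_comp, hx, hy, add_zero]

lemma isAdditiveSieve_factorSieve {A B : C} (h : A ⟶ B) : IsAdditiveSieve (factorSieve h) where
  zero _ _ := ⟨0, zero_comp⟩
  add := by
    rintro _ _ _ _ ⟨x, rfl⟩ ⟨y, rfl⟩
    exact ⟨x + y, Preadditive.add_comp _ _ _ _ _ _⟩

/-- A sequence `A ⟶ B ⟶ Q` is pure exact if it becomes short exact after applying
`Hom(N, -)` for all finitely presentable objects `N`. -/
structure IsPureExact {A B Q : C} (i : A ⟶ B) (q : B ⟶ Q) : Prop where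
  mono : Mono i
  zero : i ≫ q = 0
  lift (N : C) [IsFinitelyPresentable.{v} N] (x : N ⟶ Q) : ∃ b : N ⟶ B, b ≫ q = x
  exact (N : C) [IsFinitelyPresentable.{v} N] (b : N ⟶ B) (hb : b ≫ q = 0) :
    ∃ a : N ⟶ A, a ≫ i = b

variable [IsLocallyFinitelyPresentable.{v} C]

/-- The square induces a map from the finitely presentable `cokernel f` to `Q`. Subtracting a lift
of it from `w` leaves `u` unaffected and lands in `A`. -/
lemma IsPureExact.isPure {A B Q : C} {i : A ⟶ B} {q : B ⟶ Q} (h : IsPureExact i q) :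
    IsPure i := by
  intro M N _ _ u f w hw
  have := h.mono
  have := isFinitelyPresentable_cokernel f
  obtain ⟨b, hb⟩ := h.lift _ (cokernel.desc f (w ≫ q) (by
    rw [← Category.assoc, ← hw, Category.assoc, h.zero, comp_zero]))
  obtain ⟨a, ha⟩ := h.exact _ (w - cokernel.π f ≫ b) (by simp [hb])
  refine ⟨a, ?_⟩
  rw [← cancel_mono i, Category.assoc, ha, hw]
  simp

lemma IsPureExact.mem_pureMonos {A B Q : C} {i : A ⟶ B} {q : B ⟶ Q} (h : IsPureExact i q) :
    pureMonos C i := ⟨h.isPure, h.mono⟩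

lemma IsPureExact.exists_lift {A B Q T : C} {i : A ⟶ B} {q : B ⟶ Q} (h : IsPureExact i q)
    (t : T ⟶ B) (ht : t ≫ q = 0) : ∃ l, l ≫ i = t := by
  have := h.mono
  exact exists_lift_of_mono i t fun N _ x ↦ h.exact N _ (by rw [Category.assoc, ht, comp_zero])

lemma exists_desc_of_lift {B Q T : C} (q : B ⟶ Q)
    (hq : ∀ (N : C) [IsFinitelyPresentable.{v} N] (x : N ⟶ Q), ∃ b : N ⟶ B, b ≫ q = x)
    (t : B ⟶ T) (ht : ∀ (N : C) [IsFinitelyPresentable.{v} N] (b : N ⟶ B), b ≫ q = 0 → b ≫ t = 0) :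
    ∃ d, q ≫ d = t := by
  obtain ⟨d, hd⟩ := exists_desc (I := Unit) (fun _ ↦ B) (fun _ ↦ q) (fun N _ x ↦ ⟨(), hq N x⟩)
    (fun _ ↦ t) (fun N _ _ _ y y' h ↦ by
      rw [← sub_eq_zero, ← Preadditive.sub_comp]
      exact ht N _ (by rw [Preadditive.sub_comp, h, sub_self]))
  exact ⟨d, hd ()⟩

variable [HasBinaryBiproducts C] [HasZeroObject C]

/-- Additive sieves satisfying a left exactness condition come from subobjects. -/
lemma exists_mono_of_sieve {B : C} (S : Sieve B) (hS : IsAdditiveSieve S)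
    (h : ∀ ⦃G H : C⦄ [IsFinitelyPresentable.{v} G] [IsFinitelyPresentable.{v} H]
      (f : G ⟶ H) (z : cokernel f ⟶ B), S (cokernel.π f ≫ z) → S z) :
    ∃ (Z : C) (m : Z ⟶ B), Mono m ∧ ∀ (N : C) [IsFinitelyPresentable.{v} N] (x : N ⟶ B),
      S x ↔ ∃ y, y ≫ m = x := by
  -- The members of `kernelSieve (𝟙 B)` are the zero morphisms, so the subquotient is `S` itself.
  obtain ⟨Z, q, hq₁, hq₂, hq₃⟩ := exists_subquotient S (kernelSieve (𝟙 B)) hS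
    (isAdditiveSieve_kernelSieve _) (fun G H _ _ f y hy hfy ↦ by
      simp only [kernelSieve_apply, Category.comp_id] at hfy ⊢
      refine ⟨cokernel.desc f y hfy, h _ _ (by simpa using hy), by simp⟩)
  simp only [kernelSieve_apply, Category.comp_id, sub_eq_zero, ← Subtype.ext_iff] at hq₂
  obtain ⟨m, hm⟩ := exists_desc
    (I := Σ X : FpModel C, {x : (fpι C).obj X ⟶ B // S x}) (fun i ↦ (fpι C).obj i.1)
    (fun i ↦ q i.1 i.2) (fun N _ x ↦ by
      obtain ⟨X, ⟨e⟩⟩ := exists_fpι_iso N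
      obtain ⟨y, hy⟩ := hq₁ X (e.hom ≫ x)
      exact ⟨⟨X, y⟩, e.inv, by simp [hy]⟩) (fun i ↦ i.2.1) (fun N _ i j y y' hyy ↦ by
        obtain ⟨X, ⟨e⟩⟩ := exists_fpι_iso N
        rw [← cancel_epi e.hom, ← Category.assoc, ← Category.assoc] at hyy ⊢
        rw [hq₃, hq₃, hq₂] at hyy
        exact congr($(hyy).1))
  refine ⟨Z, m, mono_of_isFinitelyPresentable _ fun N _ x y hxy ↦ ?_, fun N _ x ↦ ⟨fun hx ↦ ?_, ?_⟩⟩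
  · obtain ⟨X, ⟨e⟩⟩ := exists_fpι_iso N
    rw [← cancel_epi e.hom]
    obtain ⟨x', hx'⟩ := hq₁ X (e.hom ≫ x)
    obtain ⟨y', hy'⟩ := hq₁ X (e.hom ≫ y)
    rw [← hx', ← hy', hq₂]
    ext
    rw [← hm ⟨X, x'⟩, ← hm ⟨X, y'⟩]
    dsimp
    rw [hx', hy', Category.assoc, Category.assoc, hxy]
  · obtain ⟨X, ⟨e⟩⟩ := exists_fpι_iso N
    exact ⟨e.inv ≫ q X ⟨e.hom ≫ x, S.downward_closed hx _⟩, by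
      simpa using e.inv ≫= hm ⟨X, ⟨e.hom ≫ x, S.downward_closed hx _⟩⟩⟩
  · rintro ⟨y, rfl⟩
    obtain ⟨X, ⟨e⟩⟩ := exists_fpι_iso N
    obtain ⟨y', hy'⟩ := hq₁ X (e.hom ≫ y)
    have := hm ⟨X, y'⟩
    dsimp at this
    rw [hy', Category.assoc] at this
    rw [(e.eq_inv_comp).2 this]
    exact S.downward_closed y'.2 _

/-- A pure monomorphism is part of a pure exact sequence. -/
lemma exists_isPureExact_of_isPure {A B : C} (h : A ⟶ B) [Mono h] (hh : IsPure h) :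
    ∃ (Q : C) (q : B ⟶ Q), IsPureExact h q := by
  obtain ⟨Q, q, hq₁, hq₂, hq₃⟩ := exists_subquotient ⊤ (factorSieve h)
    ⟨fun _ _ ↦ trivial, fun _ _ ↦ trivial⟩ (isAdditiveSieve_factorSieve h)
    (fun G H hG hH f y _ ⟨a, ha⟩ ↦ by
      -- Purity corrects `y` by an element of `A` so that it vanishes on `f`; this is the left
      -- exactness of the quotient presheaf.
      obtain ⟨g, hg⟩ := hh hG hH a f y ha
      exact ⟨cokernel.desc f (y - g ≫ h) (by simp [reassoc_of% hg, ha]), trivial,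
        (-g), by simp⟩)
  obtain ⟨p, hp⟩ := exists_desc
    (I := Σ X : FpModel C, ((fpι C).obj X ⟶ B)) (fun i ↦ (fpι C).obj i.1)
    (fun i ↦ i.2) (fun N _ x ↦ by
      obtain ⟨X, ⟨e⟩⟩ := exists_fpι_iso N
      exact ⟨⟨X, e.hom ≫ x⟩, e.inv, by simp⟩) (fun i ↦ q i.1 ⟨i.2, trivial⟩)
      (fun N _ i j y y' hyy ↦ by
        obtain ⟨X, ⟨e⟩⟩ := exists_fpι_iso N
        rw [← cancel_epi e.hom, ← Category.assoc, ← Category.assoc] at hyy ⊢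
        rw [hq₃, hq₃, hq₂, hyy]
        simpa using (isAdditiveSieve_factorSieve h).zero _)
  have hp' (X : FpModel C) (x : (fpι C).obj X ⟶ B) : x ≫ p = 0 ↔ ∃ a, a ≫ h = x := by
    have h0 : q X ⟨0, trivial⟩ = 0 := by
      have := hq₃ X X 0 ⟨0, trivial⟩
      simpa using this.symm
    rw [hp ⟨X, x⟩, ← h0, hq₂]
    simp [factorSieve_apply]
  have hp'' (N : C) [IsFinitelyPresentable.{v} N] (x : N ⟶ B) : x ≫ p = 0 ↔ ∃ a, a ≫ h = x := by
    obtain ⟨X, ⟨e⟩⟩ := exists_fpι_iso N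
    rw [← cancel_epi e.hom, comp_zero, ← Category.assoc, hp']
    exact ⟨fun ⟨a, ha⟩ ↦ ⟨e.inv ≫ a, by simp [ha]⟩, fun ⟨a, ha⟩ ↦ ⟨e.hom ≫ a, by simp [ha]⟩⟩
  refine ⟨Q, p, inferInstance, hom_ext_of_isFinitelyPresentable fun N _ x ↦ ?_, fun N _ x ↦ ?_,
    fun N _ b hb ↦ (hp'' N b).1 hb⟩
  · rw [comp_zero, ← Category.assoc, hp'']
    exact ⟨x, rfl⟩
  · obtain ⟨X, ⟨e⟩⟩ := exists_fpι_iso N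
    obtain ⟨y, hy⟩ := hq₁ X (e.hom ≫ x)
    exact ⟨e.inv ≫ y.1, by rw [Category.assoc, hp ⟨X, y.1⟩, hy]; simp⟩

/-- A morphism along which all morphisms from finitely presentable objects lift is part of
a pure exact sequence. -/
lemma exists_isPureExact_of_lift {B Q : C} (q : B ⟶ Q)
    (hq : ∀ (N : C) [IsFinitelyPresentable.{v} N] (x : N ⟶ Q), ∃ b : N ⟶ B, b ≫ q = x) :
    ∃ (A : C) (i : A ⟶ B), IsPureExact i q := by
  obtain ⟨A, i, hi, h⟩ := exists_mono_of_sieve (kernelSieve q) (isAdditiveSieve_kernelSieve q)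
    (fun G H _ _ f z hz ↦ by
      rw [kernelSieve_apply, Category.assoc] at hz
      exact (cancel_epi (cokernel.π f)).1 (by rw [hz, comp_zero]))
  exact ⟨A, i, hi, hom_ext_of_isFinitelyPresentable fun N _ x ↦ by
    rw [comp_zero, ← Category.assoc]
    exact (h N _).2 ⟨x, rfl⟩, hq, fun N _ b hb ↦ (h N b).1 hb⟩

open ZeroObject in
omit [HasBinaryBiproducts C] in
lemma IsPure.mono {A B : C} {h : A ⟶ B} (hh : IsPure h) : Mono h :=
  mono_of_isFinitelyPresentable _ fun N _ x y hxy ↦ by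
    have := isFinitelyPresentable_zero (C := C)
    -- Purity for the square with `N ⟶ 0` makes `x - y` factor through zero.
    obtain ⟨g, hg⟩ := hh (M := N) (N := 0) inferInstance inferInstance (x - y) 0 0
      (by simp [hxy])
    rw [← sub_eq_zero, ← hg, zero_comp]

end

/-! ### Pure monomorphisms are cofibrantly closed. -/

section

variable {C : Type u} [Category.{v} C]

lemma IsPure.of_comp {A B D : C} {f : A ⟶ B} {g : B ⟶ D} (h : IsPure (f ≫ g)) : IsPure f :=
  fun _ _ hM hN u p w hw ↦ h hM hN u p (w ≫ g) (by rw [reassoc_of% hw])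

lemma IsPure.comp {A B D : C} {f : A ⟶ B} {g : B ⟶ D} (hf : IsPure f) (hg : IsPure g) :
    IsPure (f ≫ g) := fun _ _ hM hN u p w hw ↦ by
  obtain ⟨a, ha⟩ := hg hM hN (u ≫ f) p w (by rw [Category.assoc, hw])
  exact hf hM hN u p a ha.symm

lemma isPure_of_isIso {A B : C} (f : A ⟶ B) [IsIso f] : IsPure f :=
  fun _ _ _ _ u p w hw ↦ ⟨w ≫ inv f, by rw [← Category.assoc, ← hw]; simp⟩

instance : (pureMonos C).IsMultiplicative where
  id_mem _ := ⟨isPure_of_isIso _, inferInstance⟩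
  comp_mem _ _ hf hg := ⟨hf.1.comp hg.1, have := hf.2; have := hg.2; mono_comp _ _⟩

instance : (pureMonos C).IsStableUnderRetracts where
  of_retract {X Y Z W f g} h hg := by
    have := hg.2
    -- `f` followed by `h.i.right` is the split, hence pure, `h.i.left` followed by `g`.
    refine ⟨IsPure.of_comp (g := h.i.right) ?_, MorphismProperty.of_retract
      (P := MorphismProperty.monomorphisms C) h hg.2⟩
    rw [← h.i_w]
    have hi : IsPure h.i.left := IsPure.of_comp (g := h.r.left) (by
      rw [h.retract_left]
      exact isPure_of_isIso (𝟙 X))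
    exact hi.comp hg.1

instance : (pureMonos C).RespectsIso where
  precomp e he f hf := by
    have : IsIso e := he
    exact (pureMonos C).comp_mem _ _ ⟨isPure_of_isIso e, inferInstance⟩ hf
  postcomp e he f hf := by
    have : IsIso e := he
    exact (pureMonos C).comp_mem _ _ hf ⟨isPure_of_isIso e, inferInstance⟩

lemma isPure_of_isColimit {J : Type v} [SmallCategory J] [IsFiltered J] {X₁ X₂ : J ⥤ C}
    {c₁ : Cocone X₁} {c₂ : Cocone X₂} (h₁ : IsColimit c₁) (h₂ : IsColimit c₂) (f : X₁ ⟶ X₂)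
    (hf : ∀ j, IsPure (f.app j)) (φ : c₁.pt ⟶ c₂.pt)
    (hφ : ∀ j, c₁.ι.app j ≫ φ = f.app j ≫ c₂.ι.app j) : IsPure φ := by
  intro M N hM hN u p w hw
  obtain ⟨i, u, rfl⟩ := IsFinitelyPresentable.exists_hom_of_isColimit h₁ u
  obtain ⟨j, w, rfl⟩ := IsFinitelyPresentable.exists_hom_of_isColimit h₂ w
  obtain ⟨k, a, b, hk⟩ := IsFinitelyPresentable.exists_eq_of_isColimit h₂
    (u ≫ f.app i) (p ≫ w) (by simpa [hφ] using hw)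
  obtain ⟨g, hg⟩ := hf k hM hN (u ≫ X₁.map a) p (w ≫ X₂.map b) (by simpa using hk)
  exact ⟨g ≫ c₁.ι.app k, by rw [reassoc_of% hg, c₁.w]⟩

variable [Preadditive C] [HasZeroObject C] [IsLocallyFinitelyPresentable.{v} C]

instance : MorphismProperty.IsStableUnderFilteredColimits.{v, v} (pureMonos C) where
  isStableUnderColimitsOfShape _ _ _ := ⟨fun _ _ _ _ h₁ h₂ f hf φ hφ ↦
    have h := isPure_of_isColimit h₁ h₂ f (fun j ↦ (hf j).1) φ hφ
    ⟨h, h.mono⟩⟩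

variable [HasBinaryBiproducts C]

instance : (pureMonos C).IsStableUnderCobaseChange where
  of_isPushout {A A' B B' h k h' k'} sq hh := by
    have := hh.2
    -- The pushout is only compared, through `e` below, with the pure cokernel of `i`; that `e` is
    -- an isomorphism is never needed.
    let i := biprod.lift (-k) h
    have hi : IsPure i := IsPure.of_comp (g := biprod.snd) (by simpa [i] using hh.1)
    have := hi.mono
    obtain ⟨Q, q, hq⟩ := exists_isPureExact_of_isPure i hi
    have hq0 : -k ≫ biprod.inl ≫ q + h ≫ biprod.inr ≫ q = 0 := by
      rw [← hq.zero]
      simp [i, biprod.lift_eq]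
    have hP : IsPure h' := by
      intro M N hM hN u f w hw
      let e := sq.desc (biprod.inl ≫ q) (biprod.inr ≫ q) (by
        rw [← sub_eq_zero, ← neg_eq_zero, ← hq0]
        abel)
      obtain ⟨b, hb⟩ := hq.lift N (w ≫ e)
      obtain ⟨a, ha⟩ := hq.exact M (u ≫ biprod.inl - f ≫ b) (by
        rw [Preadditive.sub_comp, Category.assoc, Category.assoc, hb, ← reassoc_of% hw]
        simp [e])
      have ha₁ := ha =≫ biprod.fst
      have ha₂ := ha =≫ biprod.snd
      simp [i] at ha₁ ha₂
      obtain ⟨g, hg⟩ := hh.1 hM hN a f (-(b ≫ biprod.snd)) (by simp [ha₂])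
      refine ⟨b ≫ biprod.fst - g ≫ k, ?_⟩
      rw [Preadditive.comp_sub, reassoc_of% hg, sub_eq_add_neg, ha₁]
      abel
    exact ⟨hP, hP.mono⟩

lemma isCofibrantlyClosed_pureMonos : IsCofibrantlyClosed (pureMonos C) where
  transfinite := inferInstance
  pushout := inferInstance
  retract := inferInstance

omit [HasZeroObject C] in
/-- A morphism between pure exact sequences with the same cokernel is a pushout square. -/
lemma IsPureExact.isPushout {A B A' B' Q : C} {i : A ⟶ B} {q : B ⟶ Q} {i' : A' ⟶ B'} {q' : B' ⟶ Q}
    (h : IsPureExact i q) (h' : IsPureExact i' q') {k : A ⟶ A'} {l : B ⟶ B'}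
    (hkl : i ≫ l = k ≫ i') (hl : l ≫ q' = q) : IsPushout k i i' l := by
  have := h'.mono
  -- On finitely presentable objects `A' ⊞ B ⟶ B'` is surjective, and its kernel comes from `A`.
  have hlift (N : C) [IsFinitelyPresentable.{v} N] (x : N ⟶ B') :
      ∃ b : N ⟶ A' ⊞ B, b ≫ biprod.desc i' l = x := by
    obtain ⟨b, hb⟩ := h.lift N (x ≫ q')
    obtain ⟨a, ha⟩ := h'.exact N (x - b ≫ l) (by simp [hb, hl])
    exact ⟨biprod.lift a b, by simp [ha]⟩
  have hdesc (s : PushoutCocone k i) :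
      ∃ d, biprod.desc i' l ≫ d = biprod.desc s.inl s.inr := by
    refine exists_desc_of_lift _ hlift _ fun N _ b hb ↦ ?_
    rw [biprod.desc_eq, Preadditive.comp_add, add_eq_zero_iff_eq_neg'] at hb
    obtain ⟨a, ha⟩ := h.exact N (b ≫ biprod.snd) (by
      have := hb =≫ q'
      simpa [h'.zero, hl] using this)
    have hak : a ≫ k = -(b ≫ biprod.fst) := by
      rw [← cancel_mono i', Category.assoc, ← hkl, reassoc_of% ha]
      simpa using hb
    rw [biprod.desc_eq, Preadditive.comp_add, ← Category.assoc b, ← Category.assoc b, ← ha,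
      Category.assoc a, ← s.condition, reassoc_of% hak]
    simp
  choose d hd using hdesc
  refine ⟨⟨hkl.symm⟩, ⟨PushoutCocone.IsColimit.mk _ d (fun s ↦ ?_) (fun s ↦ ?_)
    fun s m hm₁ hm₂ ↦ hom_ext_of_isFinitelyPresentable fun N _ x ↦ ?_⟩⟩
  · simpa using biprod.inl ≫= hd s
  · simpa using biprod.inr ≫= hd s
  · obtain ⟨b, rfl⟩ := hlift N x
    rw [Category.assoc, Category.assoc, hd]
    congr 1
    ext <;> simp [hm₁, hm₂]

end

/-! ### Löwenheim-Skolem for pure subobjects. -/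

/-- A set may be closed under given operations without increasing its cardinality too much. -/
lemma exists_closed_set {E Ω : Type v} (ar : Ω → Type v) (R : ∀ o, (ar o → E) → E → Prop)
    {μ : Cardinal.{v}} (hμ : ℵ₀ ≤ μ) (hΩ : #Ω ≤ μ) (har : ∀ o, μ ^ #(ar o) ≤ μ) (Z₀ : Set E)
    (hZ₀ : #Z₀ ≤ μ) :
    ∃ Z : Set E, Z₀ ⊆ Z ∧ #Z ≤ μ ∧
      ∀ o (a : ar o → E), (∀ i, a i ∈ Z) → (∃ b, R o a b) → ∃ b ∈ Z, R o a b := by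
  classical
  by_cases hE : Nonempty E
  swap
  · exact ⟨Z₀, subset_rfl, hZ₀, fun o a _ ⟨b, _⟩ ↦ (hE ⟨b⟩).elim⟩
  -- The relation becomes a function by choice; the default value `hE.some` is harmless, as only
  -- solvable instances matter.
  let op (o : Ω) (a : ar o → E) : E := if h : ∃ b, R o a b then h.choose else hE.some
  -- The closure is the set of values of well-founded terms, with the elements of `Z₀` as constants,
  -- so counting terms bounds it.
  let β : Ω ⊕ Z₀ → Type v := Sum.elim ar (fun _ ↦ PEmpty)
  let ev : WType β → E := WType.elim E (fun x ↦ match x with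
    | ⟨Sum.inl o, a⟩ => op o a
    | ⟨Sum.inr z, _⟩ => z.1)
  refine ⟨Set.range ev, fun z hz ↦ ⟨⟨Sum.inr ⟨z, hz⟩, PEmpty.elim⟩, rfl⟩, mk_range_le.trans ?_, ?_⟩
  · refine WType.cardinalMk_le_of_le ?_
    refine (sum_le_sum _ (fun _ ↦ μ) ?_).trans ?_
    · rintro (o | z)
      · exact har o
      · simpa [β] using one_le_aleph0.trans hμ
    · rw [sum_const', mk_sum, lift_id, lift_id]
      exact mul_le_of_le hμ (add_le_of_le hμ hΩ hZ₀) le_rfl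
  · intro o a ha hR
    choose t ht using ha
    refine ⟨_, ⟨⟨Sum.inl o, t⟩, rfl⟩, ?_⟩
    have : ev ⟨Sum.inl o, t⟩ = op o a := congrArg (op o) (funext ht)
    rw [this]
    simp only [op, dif_pos hR]
    exact hR.choose_spec

section

variable {C : Type u} [Category.{v} C] [IsLocallyFinitelyPresentable.{v} C]

/-- The set of all morphisms to `Q` from a small set of representatives of the finitely
presentable objects. -/
abbrev El (Q : C) : Type v := Σ X : FpModel C, ((fpι C).obj X ⟶ Q)

/-- The elements of `Q` which come from elements of `P`. -/
def elSet {P Q : C} (m : P ⟶ Q) : Set (El Q) := {e | ∃ y, y ≫ m = e.2}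

lemma mem_elSet {P Q : C} (m : P ⟶ Q) {X : FpModel C} (x : (fpι C).obj X ⟶ Q) :
    ⟨X, x⟩ ∈ elSet m ↔ ∃ y : (fpι C).obj X ⟶ P, y ≫ m = x := Iff.rfl

lemma exists_lift_iff {P Q T : C} (m : P ⟶ Q) [Mono m] (t : T ⟶ Q) :
    (∃ l, l ≫ m = t) ↔ ∀ (X : FpModel C) (g : (fpι C).obj X ⟶ T), ⟨X, g ≫ t⟩ ∈ elSet m := by
  refine ⟨?_, fun h ↦ exists_lift_of_mono m t fun N _ x ↦ ?_⟩
  · rintro ⟨l, rfl⟩ X g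
    exact ⟨g ≫ l, Category.assoc _ _ _⟩
  · obtain ⟨X, ⟨e⟩⟩ := exists_fpι_iso N
    obtain ⟨y, hy⟩ := h X (e.hom ≫ x)
    exact ⟨e.inv ≫ y, by simp [hy]⟩

lemma exists_lift_of_elSet_subset {P P' Q : C} (m : P ⟶ Q) (m' : P' ⟶ Q) [Mono m']
    (h : elSet m ⊆ elSet m') : ∃ l, l ≫ m' = m :=
  (exists_lift_iff m' m).2 fun _ g ↦ h ⟨g, rfl⟩

lemma mk_elSet {P Q : C} (m : P ⟶ Q) [Mono m] : #(elSet m) = #(El P) := by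
  refine (mk_congr (Equiv.ofBijective
    (fun e : El P ↦ (⟨⟨e.1, e.2 ≫ m⟩, e.2, rfl⟩ : elSet m)) ⟨?_, ?_⟩)).symm
  · rintro ⟨X, x⟩ ⟨Y, y⟩ h
    have h := congrArg Subtype.val h
    dsimp only at h
    obtain rfl : X = Y := congrArg Sigma.fst h
    have h := eq_of_heq (Sigma.mk.inj_iff.1 h).2
    rw [(cancel_mono m).1 h]
  · rintro ⟨⟨X, x⟩, h⟩
    obtain ⟨y, rfl⟩ := (mem_elSet m x).1 h
    exact ⟨⟨X, y⟩, rfl⟩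

/-- Objects with few elements are presentable. -/
lemma isCardinalPresentable_of_hasCardinalLT_el (Q : C) (κ : Cardinal.{v}) [Fact κ.IsRegular]
    (hκ : HasCardinalLT (Arrow (FpModel C)) κ) (hQ : HasCardinalLT (El Q) κ) :
    IsCardinalPresentable Q κ := by
  have h0 : ℵ₀ ≤ κ := IsRegular.aleph0_le Fact.out
  have hS : HasCardinalLT (Σ g : Arrow (FpModel C), ((fpι C).obj g.right ⟶ Q)) κ := by
    refine (hasCardinalLT_prod h0 hκ hQ).of_injective (fun p ↦ ⟨p.1, ⟨p.1.right, p.2⟩⟩) ?_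
    rintro ⟨g, x⟩ ⟨g', x'⟩ h
    simp only [Prod.mk.injEq, Sigma.mk.injEq] at h
    obtain ⟨rfl, -, h⟩ := h
    simpa using h
  -- An arrow over `Q` is determined by its underlying arrow and the structure map of its target.
  have hA : HasCardinalLT (Arrow (CostructuredArrow (fpι C) Q)) κ :=
    hS.of_surjective (fun p ↦ Arrow.mk (CostructuredArrow.homMk p.1.hom rfl :
      CostructuredArrow.mk ((fpι C).map p.1.hom ≫ p.2) ⟶ CostructuredArrow.mk p.2)) (by
      rintro ⟨X, Y, f⟩
      obtain ⟨X, x, rfl⟩ := X.mk_surjective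
      obtain ⟨Y, y, rfl⟩ := Y.mk_surjective
      obtain ⟨(f : X ⟶ Y), (hf : (fpι C).map f ≫ y = x), rfl⟩ :=
        CostructuredArrow.homMk_surjective f
      subst hf
      exact ⟨⟨Arrow.mk f, y⟩, rfl⟩)
  have := fact_isRegular_aleph0.{v}
  have (k : CostructuredArrow (fpι C) Q) : IsCardinalPresentable
      ((CostructuredArrow.proj (fpι C) Q ⋙ fpι C).obj k) κ :=
    isCardinalPresentable_of_le (κ := ℵ₀) ((fpι C).obj k.left) h0
  exact isCardinalPresentable_of_isColimit _ ((fpι C).denseAt Q) κ hA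

variable [Preadditive C]

/-- The sets of elements of pure subobjects. -/
structure IsPureSet {Q : C} (Z : Set (El Q)) : Prop where
  zero (X) : ⟨X, 0⟩ ∈ Z
  add (X) (x y : (fpι C).obj X ⟶ Q) (hx : ⟨X, x⟩ ∈ Z) (hy : ⟨X, y⟩ ∈ Z) : ⟨X, x + y⟩ ∈ Z
  comp (X Y) (f : (fpι C).obj X ⟶ (fpι C).obj Y) (y : (fpι C).obj Y ⟶ Q) (hy : ⟨Y, y⟩ ∈ Z) :
    ⟨X, f ≫ y⟩ ∈ Z
  ext (X Y) (f : (fpι C).obj X ⟶ (fpι C).obj Y) (y : (fpι C).obj Y ⟶ Q)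
    (hy : ⟨X, f ≫ y⟩ ∈ Z) : ∃ y', ⟨Y, y'⟩ ∈ Z ∧ f ≫ y' = f ≫ y

lemma isPureSet_elSet {P Q : C} {m : P ⟶ Q} (hm : IsPure m) : IsPureSet (elSet m) where
  zero X := ⟨0, zero_comp⟩
  add X x y hx hy := by
    rw [mem_elSet] at hx hy ⊢
    obtain ⟨x, rfl⟩ := hx
    obtain ⟨y, rfl⟩ := hy
    exact ⟨x + y, Preadditive.add_comp _ _ _ _ _ _⟩
  comp X Y f y hy := by
    rw [mem_elSet] at hy ⊢
    obtain ⟨y, rfl⟩ := hy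
    exact ⟨f ≫ y, Category.assoc _ _ _⟩
  ext X Y f y hy := by
    rw [mem_elSet] at hy
    obtain ⟨x, hx⟩ := hy
    obtain ⟨g, rfl⟩ := hm inferInstance inferInstance x f y hx
    exact ⟨g ≫ m, ⟨g, rfl⟩, by rw [← hx, Category.assoc]⟩

lemma isPureSet_iUnion {Q : C} {I : Type*} [Nonempty I] (Z : I → Set (El Q))
    (hdir : Directed (· ≤ ·) Z) (hZ : ∀ i, IsPureSet (Z i)) : IsPureSet (⋃ i, Z i) where
  zero X := Set.mem_iUnion.2 ⟨Classical.arbitrary I, (hZ _).zero X⟩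
  add X x y hx hy := by
    obtain ⟨i, hx⟩ := Set.mem_iUnion.1 hx
    obtain ⟨j, hy⟩ := Set.mem_iUnion.1 hy
    obtain ⟨k, hik, hjk⟩ := hdir i j
    exact Set.mem_iUnion.2 ⟨k, (hZ k).add X x y (hik hx) (hjk hy)⟩
  comp X Y f y hy := by
    obtain ⟨i, hy⟩ := Set.mem_iUnion.1 hy
    exact Set.mem_iUnion.2 ⟨i, (hZ i).comp X Y f y hy⟩
  ext X Y f y hy := by
    obtain ⟨i, hy⟩ := Set.mem_iUnion.1 hy
    obtain ⟨y', h, h'⟩ := (hZ i).ext X Y f y hy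
    exact ⟨y', Set.mem_iUnion.2 ⟨i, h⟩, h'⟩

variable (C) in
/-- The operations under which pure sets are closed. -/
inductive PureOp : Type v
  | zero (X : FpModel C)
  | add (X : FpModel C)
  | comp {X Y : FpModel C} (f : (fpι C).obj X ⟶ (fpι C).obj Y)
  | ext {X Y : FpModel C} (f : (fpι C).obj X ⟶ (fpι C).obj Y)

/-- The arities of the operations. -/
def PureOp.arity : PureOp C → Type v
  | zero _ => PEmpty
  | add _ => ULift Bool
  | comp _ => PUnit
  | ext _ => PUnit

instance (o : PureOp C) : Finite o.arity := by
  cases o <;> dsimp [PureOp.arity] <;> infer_instance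

/-- The graphs of the operations. -/
def PureOp.rel (Q : C) : ∀ (o : PureOp C), (o.arity → El Q) → El Q → Prop
  | zero X => fun _ b ↦ b = ⟨X, 0⟩
  | add X => fun a b ↦ ∃ x y, a ⟨true⟩ = ⟨X, x⟩ ∧ a ⟨false⟩ = ⟨X, y⟩ ∧ b = ⟨X, x + y⟩
  | comp (X := X) (Y := Y) f => fun a b ↦ ∃ y, a ⟨⟩ = ⟨Y, y⟩ ∧ b = ⟨X, f ≫ y⟩
  -- Not a function: any extension along `f` is admitted, and closure asks for one of them.
  | ext (X := X) (Y := Y) f => fun a b ↦ ∃ y, b = ⟨Y, y⟩ ∧ a ⟨⟩ = ⟨X, f ≫ y⟩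

lemma isPureSet_of_rel {Q : C} {Z : Set (El Q)}
    (h : ∀ (o : PureOp C) (a : o.arity → El Q), (∀ i, a i ∈ Z) → (∃ b, o.rel Q a b) →
      ∃ b ∈ Z, o.rel Q a b) : IsPureSet Z where
  zero X := by
    obtain ⟨_, hb, rfl⟩ := h (.zero X) PEmpty.elim (fun i ↦ i.elim) ⟨_, rfl⟩
    exact hb
  add X x y hx hy := by
    obtain ⟨_, hb, x', y', hx', hy', rfl⟩ := h (.add X)
      (fun i ↦ match i with | ⟨true⟩ => ⟨X, x⟩ | ⟨false⟩ => ⟨X, y⟩)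
      (by rintro ⟨_ | _⟩ <;> assumption) ⟨_, x, y, rfl, rfl, rfl⟩
    obtain rfl : x = x' := by simpa using hx'
    obtain rfl : y = y' := by simpa using hy'
    exact hb
  comp X Y f y hy := by
    obtain ⟨_, hb, y', hy', rfl⟩ := h (.comp f) (fun _ ↦ ⟨Y, y⟩) (fun _ ↦ hy) ⟨_, y, rfl, rfl⟩
    obtain rfl : y = y' := by simpa using hy'
    exact hb
  ext X Y f y hy := by
    obtain ⟨_, hb, y', rfl, hy'⟩ := h (.ext f) (fun _ ↦ ⟨X, f ≫ y⟩) (fun _ ↦ hy) ⟨_, y, rfl, rfl⟩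
    exact ⟨y', hb, (by simpa using hy'.symm)⟩

/-- The Löwenheim-Skolem property of pure subobjects, for subobjects which are moreover closed
under additional operations. -/
lemma exists_isPureSet {Q : C} {Ω : Type v} (ar : Ω → Type v)
    (R : ∀ o, (ar o → El Q) → El Q → Prop) {μ : Cardinal.{v}} (hμ : ℵ₀ ≤ μ) (hΩ : #Ω ≤ μ)
    (hC : #(PureOp C) ≤ μ) (har : ∀ o, μ ^ #(ar o) ≤ μ) (Z₀ : Set (El Q)) (hZ₀ : #Z₀ ≤ μ) :
    ∃ Z : Set (El Q), Z₀ ⊆ Z ∧ #Z ≤ μ ∧ IsPureSet Z ∧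
      ∀ o (a : ar o → El Q), (∀ i, a i ∈ Z) → (∃ b, R o a b) → ∃ b ∈ Z, R o a b := by
  obtain ⟨Z, h₁, h₂, h₃⟩ := exists_closed_set (Ω := PureOp C ⊕ Ω) (Sum.elim PureOp.arity ar)
    (fun o ↦ match o with | .inl o => o.rel Q | .inr o => R o) hμ
    (by rw [mk_sum, lift_id, lift_id]; exact add_le_of_le hμ hC hΩ) (by
      rintro (o | o)
      · obtain ⟨n, hn⟩ := lt_aleph0.1 (lt_aleph0_of_finite o.arity)
        dsimp
        rw [hn]
        exact power_nat_le hμ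
      · exact har o) Z₀ hZ₀
  exact ⟨Z, h₁, h₂, isPureSet_of_rel fun o ↦ h₃ (.inl o), fun o ↦ h₃ (.inr o)⟩

variable [HasBinaryBiproducts C] [HasZeroObject C]

/-- Closure under extensions does double duty: along a cokernel projection extensions are unique,
which gives the left exactness needed for a subobject, and in general it gives purity. -/
lemma IsPureSet.exists_pureMono {Q : C} {Z : Set (El Q)} (hZ : IsPureSet Z) :
    ∃ (P : C) (m : P ⟶ Q), pureMonos C m ∧ elSet m = Z := by
  let S : Sieve Q :=
    { arrows N x := ∀ (X : FpModel C) (g : (fpι C).obj X ⟶ N), ⟨X, g ≫ x⟩ ∈ Z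
      downward_closed h f X g := by simpa using h X (g ≫ f) }
  have hS (X : FpModel C) (x : (fpι C).obj X ⟶ Q) : S x ↔ ⟨X, x⟩ ∈ Z :=
    ⟨fun h ↦ by simpa using h X (𝟙 _), fun h Y g ↦ hZ.comp _ _ g x h⟩
  have hS' (M N : C) [IsFinitelyPresentable.{v} M] [IsFinitelyPresentable.{v} N]
      (f : M ⟶ N) (y : N ⟶ Q) (h : S (f ≫ y)) : ∃ y', S y' ∧ f ≫ y' = f ≫ y := by
    obtain ⟨X, ⟨e⟩⟩ := exists_fpι_iso M
    obtain ⟨Y, ⟨e'⟩⟩ := exists_fpι_iso N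
    obtain ⟨y', h₁, h₂⟩ := hZ.ext _ _ (e.hom ≫ f ≫ e'.inv) (e'.hom ≫ y) (by
      simpa using h X e.hom)
    exact ⟨e'.inv ≫ y', S.downward_closed ((hS _ _).2 h₁) _, by simpa using h₂⟩
  obtain ⟨P, m, _, hm⟩ := exists_mono_of_sieve S
    { zero N _ X g := by simpa using hZ.zero X
      add hx hy X g := by simpa using hZ.add X _ _ (hx X g) (hy X g) }
    (fun G H _ _ f z hz ↦ by
      have := isFinitelyPresentable_cokernel f
      obtain ⟨z', h₁, h₂⟩ := hS' _ _ _ z hz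
      rwa [← (cancel_epi (cokernel.π f)).1 h₂])
  refine ⟨P, m, ⟨fun M N _ _ u f w hw ↦ ?_, inferInstance⟩, ?_⟩
  · obtain ⟨w', h₁, h₂⟩ := hS' M N f w (by rw [← hw]; exact (hm _ _).2 ⟨u, rfl⟩)
    obtain ⟨y, rfl⟩ := (hm _ _).1 h₁
    exact ⟨y, by rw [← cancel_mono m, Category.assoc, h₂, hw]⟩
  · ext ⟨X, x⟩
    rw [← hS, hm]
    rfl

end

/-! ### The generating set of pure monomorphisms. -/

section

variable {C : Type u} [Category.{v} C] [IsLocallyFinitelyPresentable.{v} C] [Preadditive C]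

/-- The canonical morphism to `Q` from a coproduct of finitely presentable objects. -/
noncomputable def elCover (Q : C) : (∐ fun e : El Q ↦ (fpι C).obj e.1) ⟶ Q :=
  Sigma.desc fun e ↦ e.2

omit [Preadditive C] in
lemma exists_lift_elCover (Q : C) (N : C) [IsFinitelyPresentable.{v} N] (x : N ⟶ Q) :
    ∃ b, b ≫ elCover Q = x := by
  obtain ⟨X, ⟨e⟩⟩ := exists_fpι_iso N
  exact ⟨e.inv ≫ Sigma.ι (fun e : El Q ↦ (fpι C).obj e.1) ⟨X, e.hom ≫ x⟩, by simp [elCover]⟩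

variable [HasBinaryBiproducts C] [HasZeroObject C]

/-- The pullback of a pure exact sequence along a pure monomorphism. -/
lemma IsPureExact.exists_pullback {P B Q R : C} {m : P ⟶ B} {q : B ⟶ Q} (h : IsPureExact m q)
    {n : R ⟶ Q} (hn : pureMonos C n) :
    ∃ (P₁ : C) (i : P ⟶ P₁) (q₁ : P₁ ⟶ R) (m₁ : P₁ ⟶ B), IsPureExact i q₁ ∧ i ≫ m₁ = m ∧
      pureMonos C m₁ ∧ ∀ (N : C) [IsFinitelyPresentable.{v} N] (x : N ⟶ B) (y : N ⟶ R),
        y ≫ n = x ≫ q → ∃ z, z ≫ m₁ = x := by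
  have := hn.2
  have := h.mono
  obtain ⟨P₁, m₁, hm₁, hP₁⟩ := exists_mono_of_sieve ((factorSieve n).pullback q)
    { zero N _ := ⟨0, by simp⟩
      add := by
        rintro N _ x y ⟨x', hx⟩ ⟨y', hy⟩
        exact ⟨x' + y', by simp [hx, hy]⟩ } (fun G H hG hH f z ⟨u, hu⟩ ↦ by
      have := isFinitelyPresentable_cokernel f
      obtain ⟨g, hg⟩ := hn.1 hH this u (cokernel.π f) (z ≫ q) (by simpa using hu)
      exact ⟨g, by rw [← cancel_epi (cokernel.π f), reassoc_of% hg, hu, Category.assoc]⟩)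
  obtain ⟨i, hi⟩ := exists_lift_of_mono m₁ m fun N _ x ↦
    (hP₁ N _).1 ⟨0, by simp [h.zero]⟩
  obtain ⟨q₁, hq₁⟩ := exists_lift_of_mono n (m₁ ≫ q) fun N _ x ↦ by
    obtain ⟨y, hy⟩ := (hP₁ N (x ≫ m₁)).2 ⟨x, rfl⟩
    exact ⟨y, by simpa using hy⟩
  have hex : IsPureExact i q₁ :=
    { mono := have : Mono (i ≫ m₁) := by rwa [hi]
        mono_of_mono i m₁
      zero := by
        rw [← cancel_mono n, Category.assoc, hq₁, reassoc_of% hi, h.zero, zero_comp]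
      lift N _ x := by
        obtain ⟨b, hb⟩ := h.lift N (x ≫ n)
        obtain ⟨y, rfl⟩ := (hP₁ N b).1 ⟨x, hb.symm⟩
        exact ⟨y, by rw [← cancel_mono n, ← hb, Category.assoc, hq₁, Category.assoc]⟩
      exact N _ b hb := by
        obtain ⟨a, ha⟩ := h.exact N (b ≫ m₁) (by
          rw [Category.assoc, ← hq₁, reassoc_of% hb, zero_comp])
        exact ⟨a, by rw [← cancel_mono m₁, Category.assoc, hi, ha]⟩ }
  refine ⟨P₁, i, q₁, m₁, hex, hi, ⟨fun M N hM hN u f w hw ↦ ?_, hm₁⟩,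
    fun N _ x y hxy ↦ (hP₁ N x).1 ⟨y, hxy⟩⟩
  obtain ⟨g, hg⟩ := hn.1 hM hN (u ≫ q₁) f (w ≫ q) (by
    rw [Category.assoc, hq₁, reassoc_of% hw])
  obtain ⟨g', rfl⟩ := hex.lift N g
  obtain ⟨a, ha⟩ := hex.exact M (u - f ≫ g') (by simp [hg])
  obtain ⟨b, rfl⟩ := h.isPure hM hN a f (w - g' ≫ m₁) (by
    rw [← hi, reassoc_of% ha]
    simp [hw])
  exact ⟨g' + b ≫ i, by rw [Preadditive.comp_add, ← Category.assoc f b, ha]; abel⟩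

variable (C) in
/-- There is a small set of pure monomorphisms such that any proper pure subobject can be
enlarged by a pushout of one of them. -/
lemma exists_generating_pureMonos :
    ∃ W : MorphismProperty C, MorphismProperty.IsSmall.{v} W ∧ W ≤ pureMonos C ∧
      ∀ ⦃P B : C⦄ (m : P ⟶ B), pureMonos C m → ∀ e : El B, e ∉ elSet m →
        ∃ (P₁ : C) (i : P ⟶ P₁) (m₁ : P₁ ⟶ B), i ≫ m₁ = m ∧ pureMonos C m₁ ∧ W.pushouts i ∧
          e ∈ elSet m₁ := by
  let μ : Cardinal.{v} := max ℵ₀ (max #(PureOp C) #(Arrow (FpModel C)))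
  have hμ : ℵ₀ ≤ μ := le_max_left _ _
  -- Pure subobjects with at most `μ` elements are then `κ`-presentable, so only a set of them is
  -- needed up to isomorphism.
  let κ := Order.succ μ
  have : Fact κ.IsRegular := ⟨isRegular_succ hμ⟩
  have := fact_isRegular_aleph0.{v}
  have : IsCardinalLocallyPresentable C κ :=
    IsCardinalLocallyPresentable.of_le C (κ := ℵ₀) (hμ.trans (Order.le_succ μ))
  obtain ⟨G, _, hG₁, hG₂⟩ := ObjectProperty.EssentiallySmall.exists_small_le.{v}
    (isCardinalPresentable C κ)
  choose K r hr using fun Q : C ↦ exists_isPureExact_of_lift (elCover Q)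
    (fun N _ x ↦ exists_lift_elCover Q N x)
  refine ⟨MorphismProperty.ofHoms fun Q : Subtype G ↦ r Q.1, inferInstance, ?_, ?_⟩
  · rintro _ _ _ ⟨Q⟩
    exact (hr Q.1).mem_pureMonos
  · rintro P B m hm ⟨X, x⟩ hx
    have := hm.2
    obtain ⟨Q, q, hq⟩ := exists_isPureExact_of_isPure m hm.1
    obtain ⟨Z, hZ, hZμ, hZp, -⟩ := exists_isPureSet (Q := Q) (Ω := PEmpty.{v+1}) (fun _ ↦ PEmpty)
      (fun _ _ _ ↦ False) hμ (by simp) ((le_max_left _ _).trans (le_max_right _ _))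
      (fun o ↦ o.elim) {⟨X, x ≫ q⟩} (by simpa using one_le_aleph0.trans hμ)
    obtain ⟨R, n, hn, rfl⟩ := hZp.exists_pureMono
    have := hn.2
    have hR : IsCardinalPresentable R κ := by
      refine isCardinalPresentable_of_hasCardinalLT_el R κ ?_ ?_
      · rw [hasCardinalLT_iff_cardinal_mk_lt, Order.lt_succ_iff]
        exact (le_max_right _ _).trans (le_max_right _ _)
      · rwa [hasCardinalLT_iff_cardinal_mk_lt, Order.lt_succ_iff, ← mk_elSet n]
    obtain ⟨R', hR', ⟨e⟩⟩ := hG₂ R hR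
    obtain ⟨P₁, i, q₁, m₁, h₁, him, hm₁, hP₁⟩ := hq.exists_pullback
      ((pureMonos C).comp_mem e.inv n ⟨isPure_of_isIso _, inferInstance⟩ hn)
    have := hm₁.2
    refine ⟨P₁, i, m₁, him, hm₁, ?_, ?_⟩
    · choose l hl using fun e : El R' ↦ h₁.lift _ e.2
      have hl' : Sigma.desc l ≫ q₁ = elCover R' := Sigma.hom_ext _ _ fun e ↦ by
        simp [elCover, hl]
      obtain ⟨k, hk⟩ := h₁.exists_lift (r R' ≫ Sigma.desc l) (by
        rw [Category.assoc, hl', (hr R').zero])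
      exact MorphismProperty.pushouts_mk _ ((hr R').isPushout h₁ hk.symm hl')
        (MorphismProperty.ofHoms.mk (⟨R', hR'⟩ : Subtype G))
    · obtain ⟨y, hy⟩ := (mem_elSet n _).1 (hZ rfl)
      obtain ⟨z, hz⟩ := hP₁ _ x (y ≫ e.hom) (by simpa using hy)
      exact ⟨z, hz⟩

end

/-! ### Filtrations by pure subobjects. -/

section
variable {C : Type u} [Category.{v} C] [IsLocallyFinitelyPresentable.{v} C]

/-- A directed cocone of monomorphisms is colimiting if every morphism from a finitely
presentable object factors through one of them. -/
lemma nonempty_isColimit_of_mono {J : Type*} [Preorder J] [IsDirectedOrder J]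
    {F : J ⥤ C} (c : Cocone F) [∀ j, Mono (c.ι.app j)]
    (h : ∀ (N : C) [IsFinitelyPresentable.{v} N] (x : N ⟶ c.pt), ∃ j y, y ≫ c.ι.app j = x) :
    Nonempty (IsColimit c) := by
  have hd (s : Cocone F) : ∃ φ : c.pt ⟶ s.pt, ∀ j, c.ι.app j ≫ φ = s.ι.app j := by
    refine exists_desc F.obj (fun j ↦ c.ι.app j) h (fun j ↦ s.ι.app j) ?_
    intro N _ i j y y' hy
    obtain ⟨k, hik, hjk⟩ := exists_ge_ge i j
    rw [← s.w (homOfLE hik), ← s.w (homOfLE hjk), ← Category.assoc, ← Category.assoc]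
    congr 1
    rw [← cancel_mono (c.ι.app k)]
    simpa using hy
  choose φ hφ using hd
  refine ⟨{ desc := φ, fac := hφ, uniq := fun s f hf ↦ ?_ }⟩
  refine hom_ext_of_isFinitelyPresentable fun N _ x ↦ ?_
  obtain ⟨j, y, rfl⟩ := h N x
  rw [Category.assoc, Category.assoc, hφ, hf]

lemma exists_iso_of_elSet_eq {P P' Q : C} (m : P ⟶ Q) (m' : P' ⟶ Q) [Mono m] [Mono m']
    (h : elSet m = elSet m') : ∃ e : P ≅ P', e.hom ≫ m' = m := by
  obtain ⟨a, ha⟩ := exists_lift_of_elSet_subset m m' h.le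
  obtain ⟨b, hb⟩ := exists_lift_of_elSet_subset m' m h.ge
  exact ⟨⟨a, b, by simp [← cancel_mono m, ha, hb], by simp [← cancel_mono m', ha, hb]⟩, ha⟩

lemma elSet_id (Q : C) : elSet (𝟙 Q) = Set.univ :=
  Set.eq_univ_of_forall fun e ↦ ⟨e.2, Category.comp_id _⟩

lemma nonempty_isColimit_of_iUnion_elSet {J : Type*} [Preorder J] [IsDirectedOrder J]
    {Q : C} {F : J ⥤ C} (c : Cocone F) [∀ j, Mono (c.ι.app j)] (m : c.pt ⟶ Q) [Mono m]
    (h : elSet m ⊆ ⋃ j, elSet (c.ι.app j ≫ m)) :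
    Nonempty (IsColimit c) := by
  refine nonempty_isColimit_of_mono c fun N _ x ↦ ?_
  obtain ⟨X, ⟨e⟩⟩ := exists_fpι_iso N
  obtain ⟨j, y, hy⟩ := Set.mem_iUnion.1 (@h ⟨X, e.hom ≫ x ≫ m⟩ ⟨e.hom ≫ x, by simp⟩)
  refine ⟨j, e.inv ≫ y, ?_⟩
  rw [← cancel_mono m, ← cancel_epi e.hom]
  simpa using hy

variable [Preadditive C] [HasBinaryBiproducts C] [HasZeroObject C]

lemma exists_functor_of_isPureSet {J : Type*} [Preorder J] {Q : C} (Z : J → Set (El Q))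
    (hZ : Monotone Z) (h : ∀ j, IsPureSet (Z j)) :
    ∃ (F : J ⥤ C) (m : ∀ j, F.obj j ⟶ Q), (∀ ⦃i j⦄ (f : i ⟶ j), F.map f ≫ m j = m i) ∧
      ∀ j, pureMonos C (m j) ∧ elSet (m j) = Z j := by
  choose P m hm hZm using fun j ↦ (h j).exists_pureMono
  have hmono j : Mono (m j) := (hm j).2
  have hl {i j : J} (hij : i ≤ j) : ∃ l, l ≫ m j = m i :=
    exists_lift_of_elSet_subset _ _ (by rw [hZm, hZm]; exact hZ hij)
  choose l hl using @hl
  refine ⟨{ obj := P, map f := l (leOfHom f), map_id j := ?_, map_comp f g := ?_ },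
    m, fun i j f ↦ hl _, fun j ↦ ⟨hm j, hZm j⟩⟩
  · simp [← cancel_mono (m j), hl]
  · simp [← cancel_mono (m _), hl]

/-- If a class contains the successor steps of a pure filtration of `Q`, it contains the
transfinite composition. -/
lemma mem_of_pureFiltration {W : MorphismProperty C} (hW : IsCofibrantlyClosed W)
    {J : Type v} [LinearOrder J] [OrderBot J] [SuccOrder J] [WellFoundedLT J]
    {A Q : C} {h : A ⟶ Q} (hh : pureMonos C h) (Z : J → Set (El Q)) (hZ : Monotone Z)
    (hp : ∀ j, IsPureSet (Z j)) (h0 : Z ⊥ = elSet h)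
    (hlim : ∀ j, Order.IsSuccLimit j → Z j = ⋃ i : Set.Iio j, Z i)
    (htop : ⋃ j, Z j = Set.univ)
    (hsucc : ∀ (j : J), ¬ IsMax j → ∀ ⦃P P' : C⦄ (m : P ⟶ Q) (m' : P' ⟶ Q) (l : P ⟶ P'),
      pureMonos C m → pureMonos C m' → elSet m = Z j → elSet m' = Z (Order.succ j) →
      l ≫ m' = m → W l) : W h := by
  have := hW.transfinite
  have := hh.2
  obtain ⟨F, m, hmF, hm⟩ := exists_functor_of_isPureSet Z hZ hp
  have hmono j : Mono (m j) := (hm j).1.2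
  have hFmono {i j : J} (f : i ⟶ j) : Mono (F.map f) := by
    have : Mono (F.map f ≫ m j) := by rw [hmF]; exact hmono i
    exact mono_of_mono _ (m j)
  obtain ⟨e, he⟩ := exists_iso_of_elSet_eq (m ⊥) h ((hm ⊥).2.trans h0)
  let c : Cocone F := ⟨Q, { app := m, naturality i j f := by simp [hmF] }⟩
  have : ∀ j, Mono (c.ι.app j) := hmono
  obtain ⟨hc⟩ := nonempty_isColimit_of_iUnion_elSet c (𝟙 Q) (by
    have : ⋃ j, elSet (c.ι.app j ≫ 𝟙 Q) = Set.univ := by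
      rw [← htop]
      exact Set.iUnion_congr fun j ↦ by simpa [c] using (hm j).2
    exact this ▸ Set.subset_univ _)
  have hF : F.IsWellOrderContinuous := ⟨fun j hj ↦ by
    have : ∀ i, Mono (((Set.principalSegIio j).cocone F).ι.app i) := fun i ↦ hFmono _
    refine @nonempty_isColimit_of_iUnion_elSet _ _ _ _ _ _ _ _
      ((Set.principalSegIio j).cocone F) this (m j) (hmono j) ?_
    refine ((hm j).2.trans (hlim j hj)).subset.trans (Set.iUnion_mono fun i ↦ ?_)
    rw [← (hm i).2]
    exact le_of_eq (congrArg elSet (hmF _).symm)⟩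
  exact W.transfiniteCompositionsOfShape_le J _
    ⟨{ F := F
       isoBot := e
       isWellOrderContinuous := hF
       incl := c.ι
       isColimit := hc
       fac := by simp [c, ← he]
       map_mem j hj := hsucc j hj (m j) (m _) _ (hm _).1 (hm _).1 (hm _).2 (hm _).2
        (hmF _) }⟩

/-- Subobjects with the same elements are isomorphic, so membership in `W` can be stated for all
representatives of the two sets; this avoids tracking choices along the iteration. -/
lemma exists_isPureSet_step {W : MorphismProperty C} (hW : IsCofibrantlyClosed W)
    (hstep : ∀ ⦃P B : C⦄ (m : P ⟶ B), pureMonos C m → ∀ e : El B, e ∉ elSet m →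
      ∃ (P₁ : C) (i : P ⟶ P₁) (m₁ : P₁ ⟶ B), i ≫ m₁ = m ∧ pureMonos C m₁ ∧ W i ∧ e ∈ elSet m₁)
    {Q : C} {Z : Set (El Q)} (hZ : IsPureSet Z) (hZ' : Z ≠ Set.univ) :
    ∃ Z' : Set (El Q), Z < Z' ∧ IsPureSet Z' ∧
      ∀ ⦃P P' : C⦄ (m : P ⟶ Q) (m' : P' ⟶ Q) (l : P ⟶ P'),
        pureMonos C m → pureMonos C m' → elSet m = Z → elSet m' = Z' → l ≫ m' = m → W l := by
  have := hW.retract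
  obtain ⟨P, m, hm, rfl⟩ := hZ.exists_pureMono
  obtain ⟨e, he⟩ := (Set.ne_univ_iff_exists_notMem _).1 hZ'
  obtain ⟨P₁, i, m₁, him, hm₁, hi, he₁⟩ := hstep m hm e he
  refine ⟨elSet m₁, (Set.ssubset_iff_of_subset ?_).2 ⟨e, he₁, he⟩, isPureSet_elSet hm₁.1, ?_⟩
  · rintro x ⟨y, hy⟩
    exact ⟨y ≫ i, by simpa [him] using hy⟩
  · intro P' P₁' m' m₁' l hm' hm₁' hmm' hmm₁' hl
    have := hm.2
    have := hm'.2
    have := hm₁.2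
    have := hm₁'.2
    obtain ⟨α, hα⟩ := exists_iso_of_elSet_eq m' m hmm'
    obtain ⟨β, hβ⟩ := exists_iso_of_elSet_eq m₁' m₁ hmm₁'
    exact (W.arrow_mk_iso_iff (Arrow.isoMk α β (by
      simp [← cancel_mono m₁, hα, hβ, him, hl]))).2 hi

lemma pureMonos_le_of_isCofibrantlyClosed {W : MorphismProperty C} (hW : IsCofibrantlyClosed W)
    (hstep : ∀ ⦃P B : C⦄ (m : P ⟶ B), pureMonos C m → ∀ e : El B, e ∉ elSet m →
      ∃ (P₁ : C) (i : P ⟶ P₁) (m₁ : P₁ ⟶ B), i ≫ m₁ = m ∧ pureMonos C m₁ ∧ W i ∧ e ∈ elSet m₁) :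
    pureMonos C ≤ W := by
  classical
  intro A Q h hh
  have := hW.transfinite
  have := hW.retract
  choose! φ hφ₁ hφ₂ hφ₃ using fun (Z : Set (El Q)) (hZ : IsPureSet Z ∧ Z ≠ Set.univ) ↦
    exists_isPureSet_step hW hstep hZ.1 hZ.2
  have huniv : IsPureSet (Set.univ : Set (El Q)) := by
    rw [← elSet_id Q]
    exact isPureSet_elSet (isPure_of_isIso _)
  -- The value `Set.univ` off the proper pure sets makes `ψ` strictly increasing below the top,
  -- which it fixes.
  let ψ (Z : Set (El Q)) : Set (El Q) := if IsPureSet Z ∧ Z ≠ Set.univ then φ Z else Set.univ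
  have hψ₁ (Z) (hZ : Z ≠ ⊤) : Z < ψ Z := by
    by_cases hZ' : IsPureSet Z
    · simpa [ψ, hZ', Set.top_eq_univ ▸ hZ] using hφ₁ Z ⟨hZ', hZ⟩
    · simpa [ψ, hZ'] using lt_top_iff_ne_top.2 hZ
  have hψ₂ : ψ ⊤ = ⊤ := by simp [ψ]
  have hψ₃ (Z) : IsPureSet (ψ Z) := by
    by_cases hZ : IsPureSet Z ∧ Z ≠ Set.univ
    · simpa only [ψ, if_pos hZ] using hφ₂ Z hZ
    · simpa only [ψ, if_neg hZ] using huniv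
  -- An iteration longer than the number of subsets cannot be injective, so it reaches the top.
  let κ := Order.succ #(Set (El Q))
  have : Nonempty κ.ord.ToType := by simp [κ]
  let _ := WellFoundedLT.toOrderBot κ.ord.ToType
  let _ : SuccOrder κ.ord.ToType := SuccOrder.ofLinearWellFoundedLT _
  let Z (j : κ.ord.ToType) : Set (El Q) := transfiniteIterate ψ j (elSet h)
  have hmono : Monotone Z := monotone_transfiniteIterate _ _ fun Y ↦ by
    by_cases hY : Y = ⊤
    · rw [hY, hψ₂]
    · exact (hψ₁ Y hY).le
  have hlim (j) (hj : Order.IsSuccLimit j) : Z j = ⋃ i : Set.Iio j, Z i :=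
    transfiniteIterate_limit _ _ _ hj
  obtain ⟨j₀, hj₀⟩ := top_mem_range_transfiniteIterate (J := κ.ord.ToType) ψ (elSet h) hψ₁ hψ₂
    fun hinj ↦ (Order.lt_succ #(Set (El Q))).not_ge (by simpa [κ] using mk_le_of_injective hinj)
  have hp (j) : IsPureSet (Z j) := by
    induction j using SuccOrder.limitRecOn with
    | isMin j hj =>
      obtain rfl := hj.eq_bot
      simpa [Z] using isPureSet_elSet hh.1
    | succ j hj _ => simpa only [Z, transfiniteIterate_succ _ _ _ hj] using hψ₃ _
    | isSuccLimit j hj ih =>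
      rw [hlim j hj]
      have := hj.nonempty_Iio.to_subtype
      refine isPureSet_iUnion _ (hmono.comp (Subtype.mono_coe _)).directed_le fun i ↦ ih i i.2
  refine mem_of_pureFiltration hW hh Z hmono hp (transfiniteIterate_bot _ _) hlim
    (Set.eq_univ_of_univ_subset (hj₀.symm.le.trans (Set.subset_iUnion Z j₀))) ?_
  intro j hj P P' m m' l hm hm' hmZ hmZ' hl
  have hs : Z (Order.succ j) = ψ (Z j) := transfiniteIterate_succ _ _ _ hj
  -- After the top is reached, the remaining steps are isomorphisms.
  by_cases hj' : Z j = Set.univ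
  · have := hm.2
    have := hm'.2
    obtain ⟨e, he⟩ := exists_iso_of_elSet_eq m m' (by rw [hmZ, hmZ', hs, hj']; exact hψ₂.symm)
    obtain rfl : l = e.hom := by rw [← cancel_mono m', hl, he]
    exact W.of_isIso _
  · refine hφ₃ (Z j) ⟨hp j, hj'⟩ m m' l hm hm' hmZ ?_ hl
    rw [hmZ', hs]
    exact if_pos ⟨hp j, hj'⟩

variable (C) in
lemma exists_isCofibrantlyGeneratingSet_pureMonos :
    ∃ W : MorphismProperty C, IsCofibrantlyGeneratingSet W (pureMonos C) ∧ W ≤ pureMonos C := by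
  obtain ⟨W, hW, hle, hstep⟩ := exists_generating_pureMonos C
  refine ⟨W, ⟨hW, le_antisymm (sInf_le ⟨isCofibrantlyClosed_pureMonos, hle⟩) ?_⟩, hle⟩
  refine le_sInf fun W' ⟨hW', hWW'⟩ ↦ pureMonos_le_of_isCofibrantlyClosed hW' ?_
  intro P B m hm e he
  obtain ⟨P₁, i, m₁, him, hm₁, hi, he₁⟩ := hstep m hm e he
  have := hW'.pushout
  exact ⟨P₁, i, m₁, him, hm₁, W'.pushouts_le _ (MorphismProperty.pushouts_monotone hWW' _ hi), he₁⟩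
end

/-! ### Injectivity as a lifting property, and a criterion for accessibility. -/

section
open scoped ZeroObject
variable {C : Type u} [Category.{v} C]

lemma le_cofibrantClosure (X : MorphismProperty C) : X ≤ cofibrantClosure X :=
  le_sInf fun _ hW ↦ hW.2

lemma isCofibrantlyClosed_llp (T : MorphismProperty C) : IsCofibrantlyClosed T.llp :=
  ⟨inferInstance, inferInstance, inferInstance⟩

lemma injectives_antitone {W W' : MorphismProperty C} (h : W ≤ W') :
    injectives W' ≤ injectives W :=
  fun _ hQ _ _ f hf ↦ hQ f (h _ hf)

lemma llp_zero_iff [HasZeroObject C] [HasZeroMorphisms C] {A B : C} (f : A ⟶ B) (Q : C) :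
    (MorphismProperty.ofHoms fun _ : Unit ↦ (0 : Q ⟶ (0 : C))).llp f ↔
      ∀ a : A ⟶ Q, ∃ b : B ⟶ Q, f ≫ b = a := by
  refine ⟨fun h a ↦ ?_, fun h ↦ ?_⟩
  · have := h _ (MorphismProperty.ofHoms.mk ())
    let sq : CommSq a f (0 : Q ⟶ (0 : C)) 0 := ⟨by simp⟩
    exact ⟨sq.lift, sq.fac_left⟩
  · rintro _ _ _ ⟨⟩
    refine ⟨fun {a b} _ ↦ ?_⟩
    obtain ⟨l, hl⟩ := h a
    exact ⟨⟨⟨l, hl, (isZero_zero C).eq_of_tgt _ _⟩⟩⟩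

lemma injectives_cofibrantClosure [HasZeroObject C] [HasZeroMorphisms C]
    (X : MorphismProperty C) : injectives (cofibrantClosure X) = injectives X := by
  refine le_antisymm (injectives_antitone (le_cofibrantClosure X)) fun Q hQ ↦ ?_
  have : cofibrantClosure X ≤ (MorphismProperty.ofHoms fun _ : Unit ↦ (0 : Q ⟶ (0 : C))).llp :=
    sInf_le ⟨isCofibrantlyClosed_llp _, fun A B f hf ↦ (llp_zero_iff f Q).2 (hQ f hf)⟩
  exact fun A B f hf ↦ (llp_zero_iff f Q).1 (this f hf)

/-- A morphism from a `κ`-presentable domain factors through a stage of the colimit, where it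
extends; the codomains play no role. -/
lemma injectives_isClosedUnderColimitsOfShape (W : MorphismProperty C) (κ : Cardinal.{v})
    [Fact κ.IsRegular] (hW : ∀ ⦃A B : C⦄ (f : A ⟶ B), W f → IsCardinalPresentable A κ)
    (J : Type v) [SmallCategory J] [IsCardinalFiltered J κ] :
    (injectives W).IsClosedUnderColimitsOfShape J where
  colimitsOfShape_le := fun Q ⟨p⟩ A B f hf a ↦ by
    have := hW f hf
    obtain ⟨j, a, rfl⟩ := IsCardinalPresentable.exists_hom_of_isColimit κ p.isColimit a
    obtain ⟨b, rfl⟩ := p.prop_diag_obj j f hf a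
    exact ⟨b ≫ p.ι.app j, by simp⟩

/-- A full subcategory of a locally presentable category is accessible if it is closed under
`κ`-filtered colimits and consists of `κ`-filtered colimits of `κ`-presentable objects
belonging to it. -/
lemma isCardinalAccessibleCategory_fullSubcategory (P : ObjectProperty C) (κ : Cardinal.{v})
    [Fact κ.IsRegular] [IsCardinalLocallyPresentable C κ]
    (hP : ∀ (J : Type v) [SmallCategory J] [IsCardinalFiltered J κ],
      P.IsClosedUnderColimitsOfShape J)
    (h : ∀ Q, P Q → ∃ (J : Type v) (_ : SmallCategory J) (_ : IsCardinalFiltered J κ),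
      (P ⊓ isCardinalPresentable C κ).colimitsOfShape J Q) :
    IsCardinalAccessibleCategory P.FullSubcategory κ := by
  have hcol : HasCardinalFilteredColimits.{v} P.FullSubcategory κ :=
    ⟨fun J _ _ ↦ have := hP J; inferInstance⟩
  have hpres {J : Type v} [SmallCategory J] [IsCardinalFiltered J κ] :
      PreservesColimitsOfShape J P.ι := have := hP J; inferInstance
  let G : ObjectProperty P.FullSubcategory := (isCardinalPresentable C κ).inverseImage P.ι
  have hG : ObjectProperty.EssentiallySmall.{v} G := by
    have : ObjectProperty.EssentiallySmall.{v} (P ⊓ isCardinalPresentable C κ) :=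
      .of_le inf_le_right
    obtain ⟨R, _, hR₁, hR₂⟩ :=
      ObjectProperty.EssentiallySmall.exists_small_le.{v} (P ⊓ isCardinalPresentable C κ)
    refine ⟨.ofObj fun X : Subtype R ↦ ⟨X.1, (hR₁ _ X.2).1⟩, inferInstance, fun X hX ↦ ?_⟩
    obtain ⟨Y, hY, ⟨e⟩⟩ := hR₂ X.obj ⟨X.property, hX⟩
    exact ⟨_, ⟨(⟨Y, hY⟩ : Subtype R)⟩, ⟨P.fullyFaithfulι.preimageIso e⟩⟩
  have hgen : G.IsCardinalFilteredGenerator κ := by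
    refine ⟨fun X (hX : IsCardinalPresentable X.obj κ) ↦ ⟨fun J _ _ ↦ ?_⟩, fun X ↦ ?_⟩
    · have := preservesColimitsOfShape_of_isCardinalPresentable X.obj κ J
      exact preservesColimitsOfShape_of_natIso (F := P.ι ⋙ coyoneda.obj (op X.obj))
        (NatIso.ofComponents fun Y ↦ (P.fullyFaithfulι.homEquiv (X := X) (Y := Y)).symm.toIso)
    · obtain ⟨J, _, _, ⟨p⟩⟩ := h X.obj X.property
      refine ⟨J, inferInstance, inferInstance, ⟨?_⟩⟩
      exact
        { diag := P.lift p.diag fun j ↦ (p.prop_diag_obj j).1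
          ι := { app j := P.homMk (p.ι.app j), naturality i j f := by ext; simp }
          isColimit := isColimitOfReflects P.ι (p.isColimit)
          prop_diag_obj j := (p.prop_diag_obj j).2 }
  have : LocallySmall.{v} P.FullSubcategory := inferInstance
  have := hgen.hasCardinalFilteredGenerator
  exact { }
end

/-! ### Accessibility of small-injectivity classes. -/

section
variable {C : Type u} [Category.{v} C] [IsLocallyFinitelyPresentable.{v} C]

/-- The relation expressing that the set of elements of a subobject is closed under
chosen extensions of morphisms along a family of morphisms. -/
def extensionRel {I : Type v} {A B : I → C} {Q : C} (ext : ∀ i, (A i ⟶ Q) → (B i ⟶ Q))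
    (o : Σ i, El (B i)) (a : El (A o.1) → El Q) (b : El Q) : Prop :=
  ∃ φ : A o.1 ⟶ Q, (∀ x, a x = ⟨x.1, x.2 ≫ φ⟩) ∧ b = ⟨o.2.1, o.2.2 ≫ ext o.1 φ⟩

/-- A set of elements is closed under the relations `R`. -/
def IsClosedUnder {Ω : Type*} {ar : Ω → Type*} {T : Type*} (R : ∀ o, (ar o → T) → T → Prop)
    (Z : Set T) : Prop :=
  ∀ o (a : ar o → T), (∀ i, a i ∈ Z) → (∃ b, R o a b) → ∃ b ∈ Z, R o a b

/-- A morphism `A i ⟶ P` is recorded by its values on `El (A i)`, which determine it by density.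
Closure says that the chosen extension of its composite with `m` has all its elements in `P`, so it
factors through `m`. -/
lemma injectives_of_isClosedUnder_extensionRel {I : Type v} {A B : I → C} (f : ∀ i, A i ⟶ B i)
    {Q : C} (ext : ∀ i, (A i ⟶ Q) → (B i ⟶ Q)) (hext : ∀ i φ, f i ≫ ext i φ = φ)
    {P : C} (m : P ⟶ Q) [Mono m] (hm : IsClosedUnder (extensionRel ext) (elSet m)) :
    injectives (MorphismProperty.ofHoms f) P := by
  rintro _ _ _ ⟨i⟩ a
  obtain ⟨b, hb⟩ := (exists_lift_iff m (ext i (a ≫ m))).2 fun X y ↦ by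
    obtain ⟨_, hb, φ, hφ, rfl⟩ := hm ⟨i, X, y⟩ (fun x ↦ ⟨x.1, x.2 ≫ a ≫ m⟩)
      (fun x ↦ ⟨x.2 ≫ a, Category.assoc _ _ _⟩) ⟨_, a ≫ m, fun _ ↦ rfl, rfl⟩
    obtain rfl : a ≫ m = φ := hom_ext_of_isFinitelyPresentable fun N _ x ↦ by
      obtain ⟨Y, ⟨e⟩⟩ := exists_fpι_iso N
      rw [← cancel_epi e.hom]
      simpa using hφ ⟨Y, e.hom ≫ x⟩
    exact hb
  exact ⟨b, by rw [← cancel_mono m, Category.assoc, hb, hext]⟩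

variable [Preadditive C] [HasBinaryBiproducts C] [HasZeroObject C]

/-- `Q` is the union of its pure subobjects of size at most `μ` that are closed under chosen
extensions. `hA` lets operations of arity `El (A i)` be added to the Löwenheim-Skolem closure
without exceeding `μ`. -/
lemma colimitsOfShape_injectives {I : Type v} {A B : I → C} (f : ∀ i, A i ⟶ B i)
    {μ : Cardinal.{v}} (hμ : ℵ₀ ≤ μ) [Fact (Order.succ μ).IsRegular]
    (hB : #(Σ i, El (B i)) ≤ μ) (hC : #(PureOp C) ≤ μ) (hF : #(Arrow (FpModel C)) ≤ μ)
    (hA : ∀ i, μ ^ #(El (A i)) ≤ μ) (Q : C) (hQ : injectives (MorphismProperty.ofHoms f) Q) :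
    ∃ (J : Type v) (_ : SmallCategory J) (_ : IsCardinalFiltered J (Order.succ μ)),
      (injectives (MorphismProperty.ofHoms f) ⊓
        isCardinalPresentable C (Order.succ μ)).colimitsOfShape J Q := by
  choose ext hext using fun i ↦ hQ (f i) (.mk i)
  let J := {Z : Set (El Q) // IsPureSet Z ∧ IsClosedUnder (extensionRel ext) Z ∧ #Z ≤ μ}
  have hJ (Z₀ : Set (El Q)) (h₀ : #Z₀ ≤ μ) : ∃ Z : J, Z₀ ⊆ Z.1 := by
    obtain ⟨Z, h₁, h₂, h₃, h₄⟩ := exists_isPureSet (Q := Q) (fun o : Σ i, El (B i) ↦ El (A o.1))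
      (extensionRel ext) hμ hB hC (fun o ↦ hA o.1) Z₀ h₀
    exact ⟨⟨Z, h₃, h₄, h₂⟩, h₁⟩
  have hfil : IsCardinalFiltered J (Order.succ μ) := by
    -- A union of at most `μ` sets of size at most `μ` still has size at most `μ`, and its closure
    -- is an upper bound.
    refine isCardinalFiltered_preorder J _ fun K s hK ↦ ?_
    obtain ⟨Z, hZ⟩ := hJ (⋃ k, (s k).1) <| (mk_iUnion_le_sum_mk).trans <|
      (sum_le_sum _ (fun _ ↦ μ) fun k ↦ (s k).2.2.2).trans (by
        simpa using mul_le_of_le hμ (Order.lt_succ_iff.1 hK) le_rfl)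
    exact ⟨Z, fun k ↦ (Set.subset_iUnion (fun k ↦ (s k).1) k).trans hZ⟩
  have := isFiltered_of_isCardinalFiltered J (Order.succ μ)
  obtain ⟨F, m, hmF, hm⟩ := exists_functor_of_isPureSet (fun Z : J ↦ Z.1) (fun _ _ h ↦ h)
    (fun Z ↦ Z.2.1)
  have : IsDirectedOrder J := IsFiltered.isDirectedOrder J
  let c : Cocone F := ⟨Q, { app := m, naturality _ _ f := by simp [hmF] }⟩
  have (Z : J) : Mono (c.ι.app Z) := (hm Z).1.2
  obtain ⟨hc⟩ := nonempty_isColimit_of_mono c fun N _ x ↦ by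
    obtain ⟨X, ⟨e⟩⟩ := exists_fpι_iso N
    obtain ⟨j, hj⟩ := hJ {⟨X, e.hom ≫ x⟩} (by simpa using one_le_aleph0.trans hμ)
    have : (⟨X, e.hom ≫ x⟩ : El Q) ∈ elSet (m j) := (hm j).2 ▸ hj rfl
    obtain ⟨y, hy⟩ := (mem_elSet _ _).1 this
    exact ⟨j, e.inv ≫ y, by simp [c, hy]⟩
  refine ⟨J, inferInstance, hfil, ⟨{ diag := F, ι := c.ι, isColimit := hc, prop_diag_obj Z := ?_ }⟩⟩
  have := (hm Z).1.2
  refine ⟨injectives_of_isClosedUnder_extensionRel f ext hext (m Z) ?_,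
    isCardinalPresentable_of_hasCardinalLT_el _ _ ?_ ?_⟩
  · rw [(hm Z).2]
    exact Z.2.2.1
  · rwa [hasCardinalLT_iff_cardinal_mk_lt, Order.lt_succ_iff]
  · rw [hasCardinalLT_iff_cardinal_mk_lt, Order.lt_succ_iff, ← mk_elSet (m Z), (hm Z).2]
    exact Z.2.2.2

/-- Small-injectivity classes are accessible. -/
lemma isAccessibleCategory_injectives (X : MorphismProperty C) [MorphismProperty.IsSmall.{v} X] :
    IsAccessibleCategory.{v} (injectives X).FullSubcategory := by
  obtain ⟨I, A, B, f, rfl⟩ := (MorphismProperty.isSmall_iff_eq_ofHoms.{v} X).1 inferInstance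
  let ν : Cardinal.{v} := max ℵ₀ (max (max #(Σ i, El (A i)) #(Σ i, El (B i)))
    (max #(PureOp C) #(Arrow (FpModel C))))
  have hν : ℵ₀ ≤ ν := le_max_left _ _
  -- A power of two, so that `μ ^ ν = μ` controls the infinitary operations.
  let μ : Cardinal.{v} := 2 ^ ν
  have hνμ : ν ≤ μ := (cantor ν).le
  have hμ : ℵ₀ ≤ μ := hν.trans hνμ
  have hAν (i) : #(El (A i)) ≤ ν :=
    (mk_le_of_injective (f := fun x ↦ (⟨i, x⟩ : Σ i, El (A i)))
      fun _ _ h ↦ by simpa using h).trans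
      (le_trans (le_max_left _ _) ((le_max_left _ _).trans (le_max_right _ _)))
  have hC : #(PureOp C) ≤ μ :=
    (((le_max_left _ _).trans (le_max_right _ _)).trans (le_max_right _ _)).trans hνμ
  have hF : #(Arrow (FpModel C)) ≤ μ :=
    (((le_max_right _ _).trans (le_max_right _ _)).trans (le_max_right _ _)).trans hνμ
  have hB : #(Σ i, El (B i)) ≤ μ :=
    (((le_max_right _ _).trans (le_max_left _ _)).trans (le_max_right _ _)).trans hνμ
  have : Fact (Order.succ μ).IsRegular := ⟨isRegular_succ hμ⟩
  have := fact_isRegular_aleph0.{v}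
  have : IsCardinalLocallyPresentable C (Order.succ μ) :=
    IsCardinalLocallyPresentable.of_le C (κ := ℵ₀) (hμ.trans (Order.le_succ μ))
  refine ⟨Order.succ μ, inferInstance,
    isCardinalAccessibleCategory_fullSubcategory _ _ (fun J _ _ ↦ ?_) ?_⟩
  · refine injectives_isClosedUnderColimitsOfShape _ (Order.succ μ) ?_ J
    rintro _ _ _ ⟨i⟩
    refine isCardinalPresentable_of_hasCardinalLT_el _ _ ?_ ?_
    · rwa [hasCardinalLT_iff_cardinal_mk_lt, Order.lt_succ_iff]
    · rw [hasCardinalLT_iff_cardinal_mk_lt, Order.lt_succ_iff]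
      exact (hAν i).trans hνμ
  · refine colimitsOfShape_injectives f hμ hB hC hF fun i ↦ ?_
    rw [← power_mul]
    exact power_le_power_left two_ne_zero (mul_le_of_le hν le_rfl (hAν i))
end

end PurityInCategories

theorem mainTheorem5 (C : Type u) [Category.{v} C] [Preadditive C] [HasFiniteBiproducts C]
    [IsLocallyFinitelyPresentable.{v} C] :
    (∃ X : MorphismProperty C,
      PurityInCategories.IsCofibrantlyGeneratingSet X (PurityInCategories.pureMonos C) ∧
      X ≤ PurityInCategories.pureMonos C) ∧
    (∀ X : MorphismProperty C,
      PurityInCategories.IsCofibrantlyGeneratingSet X (PurityInCategories.pureMonos C) →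
      PurityInCategories.pureInjectives C = PurityInCategories.injectives X) ∧
    PurityInCategories.IsSmallInjectivityClass (PurityInCategories.pureInjectives C) ∧
    IsAccessibleCategory.{v} (PurityInCategories.pureInjectives C).FullSubcategory := by
  have : HasBinaryBiproducts C := hasBinaryBiproducts_of_finite_biproducts C
  obtain ⟨X, hX, hX'⟩ := PurityInCategories.exists_isCofibrantlyGeneratingSet_pureMonos C
  have h (Y : MorphismProperty C)
      (hY : PurityInCategories.IsCofibrantlyGeneratingSet Y (PurityInCategories.pureMonos C)) :
      PurityInCategories.pureInjectives C = PurityInCategories.injectives Y := by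
    rw [← PurityInCategories.injectives_cofibrantClosure Y, hY.closure_eq]
    rfl
  have := hX.small
  refine ⟨⟨X, hX, hX'⟩, h, ⟨X, hX.small, h X hX⟩, ?_⟩
  rw [h X hX]
  exact PurityInCategories.isAccessibleCategory_injectives X
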